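/- **Conformal Raychaudhuri equation in $f(R)+L_m$ gravity.** *Setting.* Let $(M,g)$ be a smooth four-dimensional spacetime of signature $(-,+,+,+)$ which is spatially homogeneous: there are a smooth function $t:M\to\mathbb R$ and a vector field $n=\partial/\partial t$ with $g(n,n)=-1$, $dt(n)=1$, $n$ orthogonal to the level sets of $t$, and any two points of the same level set are related by an isometry of $(M,g)$. Let $R_{ab}$ and $R$ be the Ricci tensor and the scalar curvature of $g$. Let $D\subset\mathbb R$ be an open set containing all values of $R$, and let $f$ be a smooth function on $D$ with $f'>0$, $f''\neq 0$ on $D$ and $f'$ injective on $D$. Let $T_{ab}$ be a covariant two-tensor field (the stress tensor of $L_m$), with trace $T=g^{ab}T_{ab}$. The $f(R)$ equations with matter are $$f'R_{ab}-\tfrac12 f g_{ab}-\nabla_a\nabla_b f'+g_{ab}\Box f'=T_{ab},\qquad(1)$$ with trace $f'R-2f+3\Box f'=T$ $\;(1')$. No field equation is assumed unless this is said. For a metric $g$ and a unit timelike field $n$ put $h_{ab}=g_{ab}+n_an_b$, $K_{ab}=h_a{}^ch_b{}^d\nabla_{(c}n_{d)}$, $K=h^{ab}K_{ab}$, $\sigma_{ab}=K_{ab}-\tfrac13Kh_{ab}$,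 $2\sigma^2=\sigma_{ab}\sigma^{ab}$. Put $\phi=\ln f'(R)$, $\tilde g=f'(R)\,g=e^{\phi}g$, $\tilde n=e^{-\phi/2}n$, $\tilde T_{ab}=e^{-\phi}T_{ab}$, and $\tilde T=\tilde g^{ab}\tilde T_{ab}=e^{-2\phi}T$. Let $$V(\phi)=\tfrac12 (f')^{-2}(Rf'-f)$$ (as a function of $\phi$, through the inverse of $R\mapsto\ln f'(R)$ on $D$), $V_*=\tfrac23V$, and $$\tilde W_{ab}=\tfrac32\big(\partial_a\phi\,\partial_b\phi-\tfrac12\tilde g_{ab}(\tilde\nabla\phi)^2\big)-\tilde g_{ab}V(\phi)+\tilde T_{ab}.$$ Quantities with a tilde are formed from $(\tilde g,\tilde n)$; the dot on them and on $\phi$ below is the derivative along $\tilde n$. *Conclusions.* $\tilde g$ is a smooth Lorentz metric, and $\tilde n$ is $\tilde g$-unit and $\tilde g$-orthogonal to the level sets of $t$. At every point of $M$: 1. $n$ is geodesic, $K_{ab}=\nabla_an_b$, and $\dfrac{dK}{dt}=-\tfrac13K^2-2\sigma^2-R_{ab}n^an^b.$ 2. $\tilde K=\tilde\nabla_a\tilde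 n^a$ and $\dot{\tilde K}=-\tfrac13\tilde K^2-2\tilde\sigma^2-\tilde R_{ab}\tilde n^a\tilde n^b+\tilde\nabla_a\dot{\tilde n}^a$, where $\dot{\tilde n}^a=\tilde n^c\tilde\nabla_c\tilde n^a$. Moreover $\dot{\tilde n}^a=0$, so that $$\dot{\tilde K}=-\tfrac13\tilde K^2-2\tilde\sigma^2-\tilde R_{ab}\tilde n^a\tilde n^b.\qquad(2)$$ 3. $V$ is differentiable at $\phi$. The $f(R)$ equations (1) hold if and only if the Einstein equations $\tilde G_{ab}=\tilde W_{ab}$ hold. The trace equation $(1')$ holds if and only if $$\ddot\phi+\tilde K\dot\phi+\frac{dV_*}{d\phi}=-\tfrac13\tilde T.\qquad(3)$$ 4. The following two systems are equivalent: (i) the Raychaudhuri equation of item 1 with $R_{ab}$ replaced by the value $(f')^{-1}\big(T_{ab}+\tfrac12fg_{ab}+\nabla_a\nabla_bf'-g_{ab}\Box f'\big)$ prescribed by the $f(R)$ equations, together with $(1')$; (ii) the Raychaudhuri equation (2) with $\tilde R_{ab}$ replaced by the value $\tilde W_{ab}-\tfrac12\tilde g_{ab}\tilde W$, $\tilde W=\tilde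 g^{cd}\tilde W_{cd}$, prescribed by the Einstein equations, together with (3). 5. If (1) holds at the point, then $\tilde R_{ab}=\tilde W_{ab}-\tfrac12\tilde g_{ab}\tilde W$, and (2), with this Ricci tensor, and (3) hold. In this case the wave equation without source, $\ddot\phi+\tilde K\dot\phi+dV_*/d\phi=0$, holds if and only if $T=0$ (in particular in vacuum and for trace-free matter). -/

import Mathlib

open scoped Manifold ContDiff

noncomputable section

namespace ConfRay

/-- The model space of a four-dimensional manifold. -/
abbrev E4 : Type := EuclideanSpace ℝ (Fin 4)

/-! ### Tensor calculus in one coordinate system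

`G x` is the matrix `g_{ab}(x)` of the metric, `(G x)⁻¹` is the matrix `g^{ab}(x)`.
A vector field is given by its components `X x a = X^a(x)`. -/

/-- The partial derivative `∂_a u`. -/
def pd (u : E4 → ℝ) (a : Fin 4) (x : E4) : ℝ :=
  fderiv ℝ u x (EuclideanSpace.single a 1)

/-- `Γ^c_{ab} = ½ g^{cd} (∂_a g_{bd} + ∂_b g_{ad} - ∂_d g_{ab})`. -/
def christoffel (G : E4 → Matrix (Fin 4) (Fin 4) ℝ) (c a b : Fin 4) (x : E4) : ℝ :=
  (1 / 2) * ∑ d, (G x)⁻¹ c d *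
    (pd (fun y => G y b d) a x + pd (fun y => G y a d) b x - pd (fun y => G y a b) d x)

/-- The Ricci tensor
`R_{ab} = ∂_c Γ^c_{ab} - ∂_b Γ^c_{ac} + Γ^c_{cd} Γ^d_{ab} - Γ^c_{bd} Γ^d_{ac}`. -/
def ricci (G : E4 → Matrix (Fin 4) (Fin 4) ℝ) (x : E4) : Matrix (Fin 4) (Fin 4) ℝ :=
  Matrix.of fun a b =>
    (∑ c, (pd (christoffel G c a b) c x - pd (christoffel G c a c) b x)) +
    ∑ c, ∑ d, (christoffel G c c d x * christoffel G d a b x -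
      christoffel G c b d x * christoffel G d a c x)

/-- The trace `g^{ab} S_{ab}`. -/
def trace (G : E4 → Matrix (Fin 4) (Fin 4) ℝ) (S : Matrix (Fin 4) (Fin 4) ℝ) (x : E4) : ℝ :=
  ∑ a, ∑ b, (G x)⁻¹ a b * S a b

/-- The contraction `S_{ab} X^a X^b`. -/
def contract (S : Matrix (Fin 4) (Fin 4) ℝ) (X : Fin 4 → ℝ) : ℝ :=
  ∑ a, ∑ b, S a b * X a * X b

/-- The Einstein tensor `G_{ab} = R_{ab} - ½ R g_{ab}`. -/
def einstein (G : E4 → Matrix (Fin 4) (Fin 4) ℝ) (x : E4) : Matrix (Fin 4) (Fin 4) ℝ :=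
  ricci G x - ((1 / 2) * trace G (ricci G x) x) • G x

/-- `∇_a w_b` for a covector field `w`. -/
def nablaCovector (G : E4 → Matrix (Fin 4) (Fin 4) ℝ) (w : E4 → Fin 4 → ℝ)
    (a b : Fin 4) (x : E4) : ℝ :=
  pd (fun y => w y b) a x - ∑ c, christoffel G c a b x * w x c

/-- `∇_a X^b` for a vector field `X`. -/
def nablaVector (G : E4 → Matrix (Fin 4) (Fin 4) ℝ) (X : E4 → Fin 4 → ℝ)
    (a b : Fin 4) (x : E4) : ℝ :=
  pd (fun y => X y b) a x + ∑ c, christoffel G b a c x * X x c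

/-- `∇_a X^a`. -/
def divergence (G : E4 → Matrix (Fin 4) (Fin 4) ℝ) (X : E4 → Fin 4 → ℝ) (x : E4) : ℝ :=
  ∑ a, nablaVector G X a a x

/-- `∇_a ∇_b u`. -/
def hessian (G : E4 → Matrix (Fin 4) (Fin 4) ℝ) (u : E4 → ℝ) (x : E4) :
    Matrix (Fin 4) (Fin 4) ℝ :=
  Matrix.of fun a b => nablaCovector G (fun y c => pd u c y) a b x

/-- `□ u = g^{ab} ∇_a ∇_b u`. -/
def box (G : E4 → Matrix (Fin 4) (Fin 4) ℝ) (u : E4 → ℝ) (x : E4) : ℝ :=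
  trace G (hessian G u x) x

/-- The derivative `X^a ∇_a u` of a function along a vector field. -/
def along (X : E4 → Fin 4 → ℝ) (u : E4 → ℝ) (x : E4) : ℝ :=
  ∑ a, X x a * pd u a x

/-- `n_b = g_{ab} n^a`. -/
def lower (G : E4 → Matrix (Fin 4) (Fin 4) ℝ) (N : E4 → Fin 4 → ℝ) (x : E4) (b : Fin 4) : ℝ :=
  ∑ a, G x a b * N x a

/-! ### Kinematics of a unit timelike vector field `n` -/

/-- The projection `h_a{}^c = δ_a{}^c + n_a n^c`. -/
def projection (G : E4 → Matrix (Fin 4) (Fin 4) ℝ) (N : E4 → Fin 4 → ℝ)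
    (x : E4) (a c : Fin 4) : ℝ :=
  (if a = c then 1 else 0) + lower G N x a * N x c

/-- The extrinsic curvature `K_{ab} = h_a{}^c h_b{}^d ∇_{(c} n_{d)}`. -/
def extrinsic (G : E4 → Matrix (Fin 4) (Fin 4) ℝ) (N : E4 → Fin 4 → ℝ)
    (a b : Fin 4) (x : E4) : ℝ :=
  ∑ c, ∑ d, projection G N x a c * projection G N x b d *
    ((1 / 2) * (nablaCovector G (lower G N) c d x + nablaCovector G (lower G N) d c x))

/-- The expansion `K = h^{ab} K_{ab}`, with `h^{ab} = g^{ab} + n^a n^b`. -/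
def expansion (G : E4 → Matrix (Fin 4) (Fin 4) ℝ) (N : E4 → Fin 4 → ℝ) (x : E4) : ℝ :=
  ∑ a, ∑ b, ((G x)⁻¹ a b + N x a * N x b) * extrinsic G N a b x

/-- The shear `σ_{ab} = K_{ab} - ⅓ K h_{ab}`, with `h_{ab} = g_{ab} + n_a n_b`. -/
def shear (G : E4 → Matrix (Fin 4) (Fin 4) ℝ) (N : E4 → Fin 4 → ℝ)
    (a b : Fin 4) (x : E4) : ℝ :=
  extrinsic G N a b x -
    (1 / 3) * expansion G N x * (G x a b + lower G N x a * lower G N x b)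

/-- The shear scalar `σ² = ½ σ_{ab} σ^{ab}`. -/
def shearSq (G : E4 → Matrix (Fin 4) (Fin 4) ℝ) (N : E4 → Fin 4 → ℝ) (x : E4) : ℝ :=
  (1 / 2) * ∑ a, ∑ b, ∑ c, ∑ d,
    (G x)⁻¹ a c * (G x)⁻¹ b d * shear G N a b x * shear G N c d x

/-- The acceleration `n^c ∇_c n^b`. -/
def acceleration (G : E4 → Matrix (Fin 4) (Fin 4) ℝ) (N : E4 → Fin 4 → ℝ)
    (x : E4) (b : Fin 4) : ℝ :=
  ∑ c, N x c * nablaVector G N c b x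

/-! ### Field equations in one coordinate system -/

/-- The `f(R)` equations with matter
`f' R_{ab} - ½ f g_{ab} - ∇_a ∇_b f' + g_{ab} □ f' = T_{ab}`; `R` is the scalar curvature. -/
def FREquations (f : ℝ → ℝ) (G : E4 → Matrix (Fin 4) (Fin 4) ℝ) (R : E4 → ℝ)
    (T : E4 → Matrix (Fin 4) (Fin 4) ℝ) (x : E4) : Prop :=
  deriv f (R x) • ricci G x - ((1 / 2) * f (R x)) • G x - hessian G (fun y => deriv f (R y)) x
    + box G (fun y => deriv f (R y)) x • G x = T x

/-- The trace `f' R - 2 f + 3 □ f' = T` of the `f(R)` equations. -/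
def FRTraceEquation (f : ℝ → ℝ) (G : E4 → Matrix (Fin 4) (Fin 4) ℝ) (R : E4 → ℝ)
    (T : E4 → Matrix (Fin 4) (Fin 4) ℝ) (x : E4) : Prop :=
  deriv f (R x) * R x - 2 * f (R x) + 3 * box G (fun y => deriv f (R y)) x = trace G (T x) x

/-- The value that the `f(R)` equations prescribe for the Ricci tensor:
`(f')⁻¹ (T_{ab} + ½ f g_{ab} + ∇_a ∇_b f' - g_{ab} □ f')`. -/
def frRicci (f : ℝ → ℝ) (G : E4 → Matrix (Fin 4) (Fin 4) ℝ) (R : E4 → ℝ)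
    (T : E4 → Matrix (Fin 4) (Fin 4) ℝ) (x : E4) : Matrix (Fin 4) (Fin 4) ℝ :=
  (deriv f (R x))⁻¹ • (T x + ((1 / 2) * f (R x)) • G x + hessian G (fun y => deriv f (R y)) x
    - box G (fun y => deriv f (R y)) x • G x)

/-- The stress tensor of the scalar field `φ` with potential `V`:
`(3/2) (∂_a φ ∂_b φ - ½ g_{ab} (∂φ)²) - g_{ab} V(φ)`. -/
def scalarStress (G : E4 → Matrix (Fin 4) (Fin 4) ℝ) (φ : E4 → ℝ) (V : ℝ → ℝ) (x : E4) :
    Matrix (Fin 4) (Fin 4) ℝ :=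
  Matrix.of fun a b =>
    (3 / 2) * (pd φ a x * pd φ b x -
      (1 / 2) * G x a b * ∑ c, ∑ d, (G x)⁻¹ c d * pd φ c x * pd φ d x) - G x a b * V (φ x)

/-- The value `S_{ab} - ½ S g_{ab}` that the Einstein equations `G_{ab} = S_{ab}`
prescribe for the Ricci tensor. -/
def einsteinRicci (G : E4 → Matrix (Fin 4) (Fin 4) ℝ) (S : Matrix (Fin 4) (Fin 4) ℝ) (x : E4) :
    Matrix (Fin 4) (Fin 4) ℝ :=
  S - ((1 / 2) * trace G S x) • G x

/-- The Raychaudhuri equation for a hypersurface-orthogonal geodesic congruence, with the tensor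
`S_{ab}` in the place of the Ricci tensor: `n^a ∇_a K = - ⅓ K² - 2 σ² - S_{ab} n^a n^b`. -/
def Raychaudhuri (G : E4 → Matrix (Fin 4) (Fin 4) ℝ) (N : E4 → Fin 4 → ℝ)
    (S : Matrix (Fin 4) (Fin 4) ℝ) (x : E4) : Prop :=
  along N (expansion G N) x =
    -(1 / 3) * expansion G N x ^ 2 - 2 * shearSq G N x - contract S (N x)

/-- The Raychaudhuri equation for a hypersurface-orthogonal congruence that need not be geodesic:
`n^a ∇_a K = - ⅓ K² - 2 σ² - R_{ab} n^a n^b + ∇_a (n^c ∇_c n^a)`. -/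
def AcceleratedRaychaudhuri (G : E4 → Matrix (Fin 4) (Fin 4) ℝ) (N : E4 → Fin 4 → ℝ)
    (x : E4) : Prop :=
  along N (expansion G N) x =
    -(1 / 3) * expansion G N x ^ 2 - 2 * shearSq G N x - contract (ricci G x) (N x)
      + divergence G (acceleration G N) x

/-- The scalar wave equation with source `s`: `φ̈ + K φ̇ + dV_*/dφ = s`, where the dot is
the derivative along `n` and `V_* = (2/3) V`. -/
def ScalarWave (G : E4 → Matrix (Fin 4) (Fin 4) ℝ) (N : E4 → Fin 4 → ℝ) (φ : E4 → ℝ)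
    (V : ℝ → ℝ) (s : ℝ) (x : E4) : Prop :=
  along N (along N φ) x + expansion G N x * along N φ x
    + deriv (fun r => (2 / 3) * V r) (φ x) = s

/-- The potential `V(φ) = ½ (f')⁻² (R f' - f)`, where `R ∈ D` is the solution of
`φ = log f'(R)`. -/
def potential (f : ℝ → ℝ) (D : Set ℝ) (φ : ℝ) : ℝ :=
  let R := Function.invFunOn (deriv f) D (Real.exp φ)
  (1 / 2) * (deriv f R ^ 2)⁻¹ * (R * deriv f R - f R)

/-! ### Fields on a four-dimensional manifold -/

section Fields

variable {M : Type*} [TopologicalSpace M] [ChartedSpace E4 M]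

/-- Components of a covariant two-tensor in the chart `e`. -/
def tensorIn (B : ∀ p : M, TangentSpace (𝓡 4) p →L[ℝ] TangentSpace (𝓡 4) p →L[ℝ] ℝ)
    (e : OpenPartialHomeomorph M E4) (x : E4) : Matrix (Fin 4) (Fin 4) ℝ :=
  Matrix.of fun a b => B (e.symm x)
    (mfderiv (𝓡 4) (𝓡 4) e.symm x (EuclideanSpace.single a (1 : ℝ) : E4))
    (mfderiv (𝓡 4) (𝓡 4) e.symm x (EuclideanSpace.single b (1 : ℝ) : E4))

/-- Components of a vector field in the chart `e`. -/
def vectorIn (X : ∀ p : M, TangentSpace (𝓡 4) p) (e : OpenPartialHomeomorph M E4)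
    (x : E4) (a : Fin 4) : ℝ :=
  let w : E4 := mfderiv (𝓡 4) (𝓡 4) e (e.symm x) (X (e.symm x))
  w a

/-- A smooth metric of signature `(-,+,+,+)`. -/
structure IsLorentzMetric
    (g : ∀ p : M, TangentSpace (𝓡 4) p →L[ℝ] TangentSpace (𝓡 4) p →L[ℝ] ℝ) : Prop where
  symm : ∀ p v w, g p v w = g p w v
  signature : ∀ p, ∃ b : Module.Basis (Fin 4) ℝ (TangentSpace (𝓡 4) p),
    ∀ i j, g p (b i) (b j) = if i = j then (if i = 0 then -1 else 1) else 0
  smooth : ∀ e ∈ IsManifold.maximalAtlas (𝓡 4) ∞ M, ∀ a b : Fin 4,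
    ContDiffOn ℝ ∞ (fun x => tensorIn g e x a b) e.target

/-- The scalar curvature `R = g^{ab} R_{ab}` at `p`, computed in the preferred chart at `p`. -/
def scalarCurvature (g : ∀ p : M, TangentSpace (𝓡 4) p →L[ℝ] TangentSpace (𝓡 4) p →L[ℝ] ℝ)
    (p : M) : ℝ :=
  trace (tensorIn g (chartAt E4 p)) (ricci (tensorIn g (chartAt E4 p)) (chartAt E4 p p))
    (chartAt E4 p p)

/-- A spatially homogeneous spacetime: the level sets of the time function `t` are spacelike
hypersurfaces any two points of which are related by an isometry, and `n = ∂/∂t` is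
their unit normal. -/
structure IsSpatiallyHomogeneous
    (g : ∀ p : M, TangentSpace (𝓡 4) p →L[ℝ] TangentSpace (𝓡 4) p →L[ℝ] ℝ)
    (t : M → ℝ) (n : ∀ p : M, TangentSpace (𝓡 4) p) : Prop where
  metric : IsLorentzMetric g
  time_smooth : ContMDiff (𝓡 4) 𝓘(ℝ, ℝ) ∞ t
  unit : ∀ p, g p (n p) (n p) = -1
  time : ∀ p, mfderiv (𝓡 4) 𝓘(ℝ, ℝ) t p (n p) = (1 : ℝ)
  orthogonal : ∀ p v, mfderiv (𝓡 4) 𝓘(ℝ, ℝ) t p v = (0 : ℝ) → g p (n p) v = 0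
  homogeneous : ∀ p q, t p = t q → ∃ Φ : M ≃ₘ^∞⟮𝓡 4, 𝓡 4⟯ M,
    (∀ r v w, g (Φ r) (mfderiv (𝓡 4) (𝓡 4) Φ r v) (mfderiv (𝓡 4) (𝓡 4) Φ r w) = g r v w) ∧
    Φ p = q

/-- `φ = log f'(R)`. -/
def confField (f : ℝ → ℝ)
    (g : ∀ p : M, TangentSpace (𝓡 4) p →L[ℝ] TangentSpace (𝓡 4) p →L[ℝ] ℝ) (p : M) : ℝ :=
  Real.log (deriv f (scalarCurvature g p))

/-- The conformal metric `g̃ = f'(R) g`. -/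
def confMetric (f : ℝ → ℝ)
    (g : ∀ p : M, TangentSpace (𝓡 4) p →L[ℝ] TangentSpace (𝓡 4) p →L[ℝ] ℝ) (p : M) :
    TangentSpace (𝓡 4) p →L[ℝ] TangentSpace (𝓡 4) p →L[ℝ] ℝ :=
  deriv f (scalarCurvature g p) • g p

/-- The vector field `ñ = e^{-φ/2} n`. -/
def confNormal (f : ℝ → ℝ)
    (g : ∀ p : M, TangentSpace (𝓡 4) p →L[ℝ] TangentSpace (𝓡 4) p →L[ℝ] ℝ)
    (n : ∀ p : M, TangentSpace (𝓡 4) p) (p : M) : TangentSpace (𝓡 4) p :=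
  Real.exp (-confField f g p / 2) • n p

/-- The matter tensor `T̃ = e^{-φ} T` of the conformal frame. -/
def confMatter (f : ℝ → ℝ)
    (g T : ∀ p : M, TangentSpace (𝓡 4) p →L[ℝ] TangentSpace (𝓡 4) p →L[ℝ] ℝ) (p : M) :
    TangentSpace (𝓡 4) p →L[ℝ] TangentSpace (𝓡 4) p →L[ℝ] ℝ :=
  Real.exp (-confField f g p) • T p

end Fields

end ConfRay

end

open Filter Topology

namespace ConfRay

section

/-! ### Partial derivatives -/

/-! The theorem rests on one function of time and one tensor.

Kinematics. The scalar curvature is invariant under isometries, so homogeneity makes it, and with it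
φ, a function of t: dφ is proportional to dt. The unit normal satisfies n_a = -∂_a t, so its
covector is closed. A unit field with closed covector has symmetric gradient, is geodesic, and obeys
the Raychaudhuri equation after commuting two covariant derivatives (`ClosedUnitOn.raychaudhuri`).
The rescaled covector e^{φ/2} n_a is closed again because dφ ∧ n = 0 (`ClosedUnitOn.scale`). Hence
one theorem serves both frames, and the acceleration vanishes in both.

Field equations. Let E_ab be the left side minus the right side of the f(R) equations
(`FrameData.residual`). The conformal transformation of the Ricci tensor gives, with no field
equation assumed, G̃ = W̃ + e^{-φ} E (`FrameData.einstein_eq`). So the f(R) and the Einstein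
equations both say E = 0. The trace equation and the wave equation both say tr E = 0
(`FrameData.scalarWave_iff`). The Raychaudhuri equations with prescribed Ricci tensor say E(n,n) = 0
in the first frame and (E - ½ (tr E) g)(n,n) = 0 in the second, and these agree once tr E = 0.

Invariance of R. Changes of chart and isometries are both maps ψ with g₁ = Jᵀ g₂ J, J the Jacobian.
The connection matrices undergo a gauge transformation under ψ, so the curvature is pulled back and
conjugated by J, and its trace R is unchanged (`IsometryOn.scalar_eq`). -/

lemma differentiableAt_of_smooth {U : Set E4} (hU : IsOpen U) {u : E4 → ℝ}
    (hu : ContDiffOn ℝ ∞ u U) {x : E4} (hx : x ∈ U) : DifferentiableAt ℝ u x :=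
  (hu.contDiffAt (hU.mem_nhds hx)).differentiableAt (by simp)

lemma contDiffOn_pd {U : Set E4} (hU : IsOpen U) {u : E4 → ℝ} (hu : ContDiffOn ℝ ∞ u U)
    (a : Fin 4) : ContDiffOn ℝ ∞ (pd u a) U :=
  (hu.fderiv_of_isOpen hU (m := ∞) (by simp)).clm_apply contDiffOn_const

lemma pd_congr {u v : E4 → ℝ} {x : E4} (h : u =ᶠ[𝓝 x] v) (a : Fin 4) : pd u a x = pd v a x := by
  unfold pd; rw [h.fderiv_eq]

lemma pd_congr_on {U : Set E4} (hU : IsOpen U) {u v : E4 → ℝ} (h : ∀ y ∈ U, u y = v y)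
    {x : E4} (hx : x ∈ U) (a : Fin 4) : pd u a x = pd v a x :=
  pd_congr (Filter.eventuallyEq_of_mem (hU.mem_nhds hx) h) a

@[simp] lemma pd_const (r : ℝ) (a : Fin 4) (x : E4) : pd (fun _ => r) a x = 0 := by
  simp [pd]

lemma pd_add {u v : E4 → ℝ} {x : E4} (hu : DifferentiableAt ℝ u x) (hv : DifferentiableAt ℝ v x)
    (a : Fin 4) : pd (fun y => u y + v y) a x = pd u a x + pd v a x := by
  simp [pd, fderiv_fun_add hu hv]

lemma pd_sub {u v : E4 → ℝ} {x : E4} (hu : DifferentiableAt ℝ u x) (hv : DifferentiableAt ℝ v x)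
    (a : Fin 4) : pd (fun y => u y - v y) a x = pd u a x - pd v a x := by
  simp [pd, fderiv_fun_sub hu hv]

lemma pd_neg (u : E4 → ℝ) (a : Fin 4) (x : E4) : pd (fun y => -u y) a x = -pd u a x := by
  simp [pd, fderiv_fun_neg]

lemma pd_mul {u v : E4 → ℝ} {x : E4} (hu : DifferentiableAt ℝ u x) (hv : DifferentiableAt ℝ v x)
    (a : Fin 4) : pd (fun y => u y * v y) a x = pd u a x * v x + u x * pd v a x := by
  simp [pd, fderiv_fun_mul hu hv]; ring

lemma pd_const_mul {u : E4 → ℝ} {x : E4} (hu : DifferentiableAt ℝ u x) (r : ℝ)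
    (a : Fin 4) : pd (fun y => r * u y) a x = r * pd u a x := by
  rw [pd_mul (by fun_prop) hu]; simp

lemma pd_sum {ι : Type*} (s : Finset ι) {u : ι → E4 → ℝ} {x : E4}
    (hu : ∀ i ∈ s, DifferentiableAt ℝ (u i) x) (a : Fin 4) :
    pd (fun y => ∑ i ∈ s, u i y) a x = ∑ i ∈ s, pd (u i) a x := by
  simp [pd, fderiv_fun_sum hu]

lemma pd_real_comp {h : ℝ → ℝ} {h' : ℝ} {u : E4 → ℝ} {x : E4} (hh : HasDerivAt h h' (u x))
    (hu : DifferentiableAt ℝ u x) (a : Fin 4) : pd (fun y => h (u y)) a x = h' * pd u a x := by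
  have := (hh.hasFDerivAt.comp x hu.hasFDerivAt).fderiv
  unfold pd
  rw [show (fun y => h (u y)) = h ∘ u from rfl, this]
  simp [mul_comm]

lemma pd_comm {U : Set E4} (hU : IsOpen U) {u : E4 → ℝ} (hu : ContDiffOn ℝ ∞ u U) {x : E4}
    (hx : x ∈ U) (a b : Fin 4) : pd (pd u a) b x = pd (pd u b) a x := by
  have h1 := hu.contDiffAt (hU.mem_nhds hx)
  have hs := h1.isSymmSndFDerivAt (by simpa using! (WithTop.coe_le_coe.2 le_top : ((2 : ℕ∞) : WithTop ℕ∞) ≤ ((⊤ : ℕ∞) : WithTop ℕ∞)))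
  have hd : DifferentiableAt ℝ (fderiv ℝ u) x :=
    ((hu.fderiv_of_isOpen hU (m := ∞) (by simp)).contDiffAt (hU.mem_nhds hx)).differentiableAt
      (by simp)
  have key (a b : Fin 4) : pd (pd u a) b x
      = fderiv ℝ (fderiv ℝ u) x (EuclideanSpace.single b 1) (EuclideanSpace.single a 1) := by
    rw [pd]
    rw [show pd u a = fun y => (fderiv ℝ u y) (EuclideanSpace.single a 1) from rfl,
      fderiv_clm_apply hd (differentiableAt_const _)]
    simp
  rw [key, key]
  exact hs _ _

lemma fderiv_apply_eq_sum (u : E4 → ℝ) (x v : E4) : fderiv ℝ u x v = ∑ b, v b * pd u b x := by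
  conv_lhs => rw [← (EuclideanSpace.basisFun (Fin 4) ℝ).sum_repr v]
  simp [pd]

lemma pd_coord {ψ : E4 → E4} {x : E4} (hψ : DifferentiableAt ℝ ψ x) (b i : Fin 4) :
    pd (fun y => ψ y b) i x = fderiv ℝ ψ x (EuclideanSpace.single i 1) b := by
  have := ((EuclideanSpace.proj b : E4 →L[ℝ] ℝ).hasFDerivAt.comp x
    hψ.hasFDerivAt).fderiv
  unfold pd
  rw [show (fun y => ψ y b) = (EuclideanSpace.proj b : E4 →L[ℝ] ℝ) ∘ ψ from rfl, this]
  simp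

/-- The chain rule. -/
lemma pd_comp {ψ : E4 → E4} {u : E4 → ℝ} {x : E4} (hψ : DifferentiableAt ℝ ψ x)
    (hu : DifferentiableAt ℝ u (ψ x)) (i : Fin 4) :
    pd (fun y => u (ψ y)) i x = ∑ b, pd (fun y => ψ y b) i x * pd u b (ψ x) := by
  have := (hu.hasFDerivAt.comp x hψ.hasFDerivAt).fderiv
  rw [pd, show (fun y => u (ψ y)) = u ∘ ψ from rfl, this, ContinuousLinearMap.comp_apply,
    fderiv_apply_eq_sum]
  simp [pd_coord hψ]

/-! ### Metrics on an open set of the model space -/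

/-- The components of a smooth pseudo-Riemannian metric on the open set `U`. -/
structure MetricOn (U : Set E4) (G : E4 → Matrix (Fin 4) (Fin 4) ℝ) : Prop where
  isOpen : IsOpen U
  smooth : ∀ a b, ContDiffOn ℝ ∞ (fun x => G x a b) U
  symm : ∀ x ∈ U, ∀ a b, G x a b = G x b a
  det_ne : ∀ x ∈ U, (G x).det ≠ 0

lemma contDiffOn_det {ι : Type*} [Fintype ι] [DecidableEq ι] {U : Set E4}
    {A : E4 → Matrix ι ι ℝ} (hA : ∀ a b, ContDiffOn ℝ ∞ (fun x => A x a b) U) :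
    ContDiffOn ℝ ∞ (fun x => (A x).det) U := by
  simp only [Matrix.det_apply]
  exact ContDiffOn.sum fun σ _ => (contDiffOn_prod fun i _ => hA _ _).const_smul _

/-- Cramer's rule: an entry of the inverse is a determinant with one row replaced by a constant one,
divided by the determinant of the matrix. -/
lemma contDiffOn_inv_entry {U : Set E4} {A : E4 → Matrix (Fin 4) (Fin 4) ℝ}
    (hA : ∀ a b, ContDiffOn ℝ ∞ (fun x => A x a b) U) (hd : ∀ x ∈ U, (A x).det ≠ 0)
    (a b : Fin 4) : ContDiffOn ℝ ∞ (fun x => (A x)⁻¹ a b) U := by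
  simp only [Matrix.inv_def, Matrix.smul_apply, Ring.inverse_eq_inv', smul_eq_mul,
    Matrix.adjugate_apply]
  refine ((contDiffOn_det hA).inv hd).mul (contDiffOn_det fun i j => ?_)
  by_cases h : i = b
  · subst h; simpa using contDiffOn_const
  · simpa [Matrix.updateRow_ne h] using hA i j

variable {U : Set E4} {G : E4 → Matrix (Fin 4) (Fin 4) ℝ} {x : E4}

namespace MetricOn

lemma diff (h : MetricOn U G) (hx : x ∈ U) (a b : Fin 4) :
    DifferentiableAt ℝ (fun x => G x a b) x :=
  differentiableAt_of_smooth h.isOpen (h.smooth a b) hx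

lemma smooth_inv (h : MetricOn U G) (a b : Fin 4) : ContDiffOn ℝ ∞ (fun x => (G x)⁻¹ a b) U :=
  contDiffOn_inv_entry h.smooth h.det_ne a b

lemma mul_inv (h : MetricOn U G) (hx : x ∈ U) : G x * (G x)⁻¹ = 1 :=
  Matrix.mul_nonsing_inv _ (h.det_ne x hx).isUnit

lemma inv_mul (h : MetricOn U G) (hx : x ∈ U) : (G x)⁻¹ * G x = 1 :=
  Matrix.nonsing_inv_mul _ (h.det_ne x hx).isUnit

lemma sum_mul_inv (h : MetricOn U G) (hx : x ∈ U) (a c : Fin 4) :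
    ∑ b, G x a b * (G x)⁻¹ b c = if a = c then 1 else 0 := by
  rw [← Matrix.mul_apply, h.mul_inv hx, Matrix.one_apply]

lemma sum_inv_mul (h : MetricOn U G) (hx : x ∈ U) (a c : Fin 4) :
    ∑ b, (G x)⁻¹ a b * G x b c = if a = c then 1 else 0 := by
  rw [← Matrix.mul_apply, h.inv_mul hx, Matrix.one_apply]

lemma transpose_eq (h : MetricOn U G) (hx : x ∈ U) : (G x).transpose = G x := by
  ext a b; exact h.symm x hx b a

lemma inv_symm (h : MetricOn U G) (hx : x ∈ U) (a b : Fin 4) : (G x)⁻¹ a b = (G x)⁻¹ b a := by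
  have := Matrix.transpose_nonsing_inv (G x)
  rw [h.transpose_eq hx] at this
  exact congrFun (congrFun this b) a

lemma smooth_christoffel (h : MetricOn U G) (c a b : Fin 4) :
    ContDiffOn ℝ ∞ (christoffel G c a b) U := by
  unfold christoffel
  refine contDiffOn_const.mul (ContDiffOn.sum fun d _ => (h.smooth_inv c d).mul ?_)
  exact ((contDiffOn_pd h.isOpen (h.smooth _ _) _).add
    (contDiffOn_pd h.isOpen (h.smooth _ _) _)).sub (contDiffOn_pd h.isOpen (h.smooth _ _) _)

lemma christoffel_symm (h : MetricOn U G) (hx : x ∈ U) (c a b : Fin 4) :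
    christoffel G c a b x = christoffel G c b a x := by
  unfold christoffel
  congr 1
  refine Finset.sum_congr rfl fun d _ => ?_
  rw [pd_congr_on h.isOpen (fun y hy => h.symm y hy a b) hx]
  ring

lemma christoffel_symm_fun (h : MetricOn U G) (hx : x ∈ U) (c a b i : Fin 4) :
    pd (christoffel G c a b) i x = pd (christoffel G c b a) i x :=
  pd_congr_on h.isOpen (fun _ hy => h.christoffel_symm hy c a b) hx i

/-- `g_{ec} Γ^c_{ab} = ½ (∂_a g_{be} + ∂_b g_{ae} - ∂_e g_{ab})`. -/
lemma lower_christoffel (h : MetricOn U G) (hx : x ∈ U) (e a b : Fin 4) :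
    ∑ c, G x e c * christoffel G c a b x = (1 / 2) *
      (pd (fun y => G y b e) a x + pd (fun y => G y a e) b x - pd (fun y => G y a b) e x) := by
  unfold christoffel
  have : ∀ v : Fin 4 → ℝ, ∑ c, G x e c * ((1 / 2) * ∑ d, (G x)⁻¹ c d * v d) = (1 / 2) * v e := by
    intro v
    simp only [Finset.mul_sum]
    rw [Finset.sum_comm]
    have : ∀ d, ∑ c, G x e c * ((1 / 2) * ((G x)⁻¹ c d * v d))
        = (1 / 2) * ((∑ c, G x e c * (G x)⁻¹ c d) * v d) := by
      intro d
      rw [Finset.sum_mul, Finset.mul_sum]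
      exact Finset.sum_congr rfl fun c _ => by ring
    rw [Finset.sum_congr rfl fun d _ => this d]
    simp [h.sum_mul_inv hx]
  exact this fun d => pd (fun y => G y b d) a x + pd (fun y => G y a d) b x
    - pd (fun y => G y a b) d x

/-- The metric is covariantly constant. -/
lemma pd_metric (h : MetricOn U G) (hx : x ∈ U) (c a b : Fin 4) :
    pd (fun y => G y a b) c x = ∑ d, G x b d * christoffel G d c a x
      + ∑ d, G x a d * christoffel G d c b x := by
  rw [h.lower_christoffel hx, h.lower_christoffel hx,
    pd_congr_on h.isOpen (fun y hy => h.symm y hy b a) hx,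
    pd_congr_on h.isOpen (fun y hy => h.symm y hy c b) hx,
    pd_congr_on h.isOpen (fun y hy => h.symm y hy c a) hx]
  ring

/-- A symmetric connection that preserves the metric is the Levi-Civita connection. -/
lemma eq_christoffel (h : MetricOn U G) (hx : x ∈ U) {C : Fin 4 → Fin 4 → Fin 4 → ℝ}
    (hs : ∀ c a b, C c a b = C c b a)
    (hc : ∀ c a b, pd (fun y => G y a b) c x = ∑ d, G x b d * C d c a + ∑ d, G x a d * C d c b)
    (c a b : Fin 4) : christoffel G c a b x = C c a b := by
  -- The Koszul argument: in the cyclic combination of three instances of `hc`, symmetry of `C`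
  -- cancels everything except the lowered `C`. Invertibility of the metric then removes the
  -- lowering.
  have hl : ∀ e, ∑ d, G x e d * christoffel G d a b x = ∑ d, G x e d * C d a b := by
    intro e
    rw [h.lower_christoffel hx, hc, hc, hc]
    simp only [hs _ b a, hs _ e a, hs _ e b]
    ring
  have : (G x).mulVec (fun d => christoffel G d a b x) = (G x).mulVec (fun d => C d a b) :=
    funext hl
  have := congrArg ((G x)⁻¹).mulVec this
  rw [Matrix.mulVec_mulVec, Matrix.mulVec_mulVec, h.inv_mul hx, Matrix.one_mulVec,
    Matrix.one_mulVec] at this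
  exact congrFun this c

end MetricOn

end

noncomputable section

/-! ### Change of coordinates -/

/-- The entrywise partial derivative of a matrix-valued function. -/
def pdMat (A : E4 → Matrix (Fin 4) (Fin 4) ℝ) (i : Fin 4) (x : E4) : Matrix (Fin 4) (Fin 4) ℝ :=
  Matrix.of fun a b => pd (fun y => A y a b) i x

/-- Entrywise differentiability at a point. -/
def MatDiffAt (A : E4 → Matrix (Fin 4) (Fin 4) ℝ) (x : E4) : Prop :=
  ∀ a b, DifferentiableAt ℝ (fun y => A y a b) x

/-! ### Calculus of matrix-valued functions -/

section pdMat

variable {A B : E4 → Matrix (Fin 4) (Fin 4) ℝ} {x : E4}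

lemma MatDiffAt.mul (hA : MatDiffAt A x) (hB : MatDiffAt B x) :
    MatDiffAt (fun y => A y * B y) x := by
  intro a b
  simp only [Matrix.mul_apply]
  exact DifferentiableAt.fun_sum fun c _ => (hA a c).mul (hB c b)

lemma MatDiffAt.sum_smul {u : Fin 4 → E4 → ℝ} {C : Fin 4 → E4 → Matrix (Fin 4) (Fin 4) ℝ}
    (hu : ∀ b, DifferentiableAt ℝ (u b) x) (hC : ∀ b, MatDiffAt (C b) x) :
    MatDiffAt (fun y => ∑ b, u b y • C b y) x := by
  intro a b
  simp only [Matrix.sum_apply, Matrix.smul_apply, smul_eq_mul]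
  exact DifferentiableAt.fun_sum fun c _ => (hu c).mul (hC c a b)

lemma pdMat_mul (hA : MatDiffAt A x) (hB : MatDiffAt B x) (i : Fin 4) :
    pdMat (fun y => A y * B y) i x = pdMat A i x * B x + A x * pdMat B i x := by
  ext a b
  simp only [pdMat, Matrix.of_apply, Matrix.add_apply, Matrix.mul_apply]
  rw [pd_sum _ (u := fun c y => A y a c * B y c b) fun c _ => (hA a c).mul (hB c b), ← Finset.sum_add_distrib]
  exact Finset.sum_congr rfl fun c _ => pd_mul (hA a c) (hB c b) i

lemma pdMat_add (hA : MatDiffAt A x) (hB : MatDiffAt B x) (i : Fin 4) :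
    pdMat (fun y => A y + B y) i x = pdMat A i x + pdMat B i x := by
  ext a b
  exact pd_add (hA a b) (hB a b) i

lemma pdMat_transpose (i : Fin 4) :
    pdMat (fun y => (A y).transpose) i x = (pdMat A i x).transpose := rfl

lemma pdMat_sum_smul {u : Fin 4 → E4 → ℝ} {C : Fin 4 → E4 → Matrix (Fin 4) (Fin 4) ℝ}
    (hu : ∀ b, DifferentiableAt ℝ (u b) x) (hC : ∀ b, MatDiffAt (C b) x) (i : Fin 4) :
    pdMat (fun y => ∑ b, u b y • C b y) i x
      = ∑ b, (pd (u b) i x • C b x + u b x • pdMat (C b) i x) := by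
  ext a b
  simp only [pdMat, Matrix.of_apply, Matrix.sum_apply, Matrix.add_apply, Matrix.smul_apply,
    smul_eq_mul]
  rw [pd_sum _ (u := fun c y => u c y * C c y a b) fun c _ => (hu c).mul (hC c a b)]
  exact Finset.sum_congr rfl fun c _ => pd_mul (hu c) (hC c a b) i

lemma pdMat_congr_on {U : Set E4} (hU : IsOpen U) (h : ∀ y ∈ U, A y = B y) (hx : x ∈ U)
    (i : Fin 4) : pdMat A i x = pdMat B i x := by
  ext a b
  exact pd_congr_on hU (fun y hy => by rw [h y hy]) hx i

lemma pdMat_comp {ψ : E4 → E4} (hψ : DifferentiableAt ℝ ψ x) (hA : MatDiffAt A (ψ x))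
    (i : Fin 4) :
    pdMat (fun y => A (ψ y)) i x = ∑ b, pd (fun y => ψ y b) i x • pdMat A b (ψ x) := by
  ext a c
  simp only [pdMat, Matrix.of_apply, Matrix.sum_apply, Matrix.smul_apply, smul_eq_mul]
  exact pd_comp (u := fun y => A y a c) hψ (hA a c) i

end pdMat

/-- The connection matrices `(Γ_i)^c_a = Γ^c_{ia}`. -/
def conn (G : E4 → Matrix (Fin 4) (Fin 4) ℝ) (i : Fin 4) (x : E4) : Matrix (Fin 4) (Fin 4) ℝ :=
  Matrix.of fun c a => christoffel G c i a x

/-- The curvature matrices `∂_i A_j - ∂_j A_i + [A_i, A_j]`. -/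
def curv (A : Fin 4 → E4 → Matrix (Fin 4) (Fin 4) ℝ) (i j : Fin 4) (x : E4) :
    Matrix (Fin 4) (Fin 4) ℝ :=
  pdMat (A j) i x - pdMat (A i) j x + A i x * A j x - A j x * A i x

/-- The Jacobian matrix `∂_i ψ^b`. -/
def jac (ψ : E4 → E4) (x : E4) : Matrix (Fin 4) (Fin 4) ℝ :=
  Matrix.of fun b i => pd (fun y => ψ y b) i x

lemma MetricOn.matDiffAt {U : Set E4} {G : E4 → Matrix (Fin 4) (Fin 4) ℝ} {x : E4}
    (h : MetricOn U G) (hx : x ∈ U) : MatDiffAt G x := h.diff hx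

lemma MetricOn.matDiffAt_conn {U : Set E4} {G : E4 → Matrix (Fin 4) (Fin 4) ℝ} {x : E4}
    (h : MetricOn U G) (hx : x ∈ U) (i : Fin 4) : MatDiffAt (conn G i) x := fun c a =>
  differentiableAt_of_smooth h.isOpen (h.smooth_christoffel c i a) hx

/-- The Ricci tensor as a contraction of the curvature of a matrix-valued one-form. In this form a
change of coordinates is a gauge transformation and needs no index computation with second
derivatives of ψ. -/
lemma MetricOn.ricci_eq_curv {U : Set E4} {G : E4 → Matrix (Fin 4) (Fin 4) ℝ} {x : E4}
    (h : MetricOn U G) (hx : x ∈ U) (a b : Fin 4) :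
    ricci G x a b = ∑ c, curv (conn G) c b x c a := by
  simp only [ricci, Matrix.of_apply, curv, pdMat, conn, Matrix.sub_apply, Matrix.add_apply,
    Matrix.mul_apply, ← Finset.sum_add_distrib]
  refine Finset.sum_congr rfl fun c _ => ?_
  rw [h.christoffel_symm_fun hx c a b c, h.christoffel_symm_fun hx c a c b, add_sub_assoc,
    ← Finset.sum_sub_distrib]
  congr 1
  refine Finset.sum_congr rfl fun d _ => ?_
  rw [h.christoffel_symm hx d a b, h.christoffel_symm hx d a c]

lemma MetricOn.pdMat_metric {U : Set E4} {G : E4 → Matrix (Fin 4) (Fin 4) ℝ} {x : E4}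
    (h : MetricOn U G) (hx : x ∈ U) (c : Fin 4) :
    pdMat G c x = (conn G c x).transpose * G x + G x * conn G c x := by
  ext a b
  simp only [pdMat, Matrix.of_apply, Matrix.add_apply, Matrix.mul_apply, Matrix.transpose_apply,
    conn]
  rw [h.pd_metric hx]
  congr 1
  exact Finset.sum_congr rfl fun d _ => by rw [h.symm x hx b d, mul_comm]

/-- Isometries between open sets of the model space. -/
structure IsometryOn (U₁ U₂ : Set E4) (G₁ G₂ : E4 → Matrix (Fin 4) (Fin 4) ℝ) (ψ : E4 → E4) :
    Prop where
  source : MetricOn U₁ G₁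
  target : MetricOn U₂ G₂
  smooth : ContDiffOn ℝ ∞ ψ U₁
  maps : Set.MapsTo ψ U₁ U₂
  pullback : ∀ x ∈ U₁, G₁ x = (jac ψ x).transpose * G₂ (ψ x) * jac ψ x

/-! ### Transformation of connection, Ricci tensor and scalar curvature -/

namespace IsometryOn

variable {U₁ U₂ : Set E4} {G₁ G₂ : E4 → Matrix (Fin 4) (Fin 4) ℝ} {ψ : E4 → E4} {x : E4}

lemma smooth_coord (h : IsometryOn U₁ U₂ G₁ G₂ ψ) (b : Fin 4) :
    ContDiffOn ℝ ∞ (fun y => ψ y b) U₁ :=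
  (EuclideanSpace.proj b : E4 →L[ℝ] ℝ).contDiff.comp_contDiffOn h.smooth

lemma diff (h : IsometryOn U₁ U₂ G₁ G₂ ψ) (hx : x ∈ U₁) : DifferentiableAt ℝ ψ x :=
  (h.smooth.contDiffAt (h.source.isOpen.mem_nhds hx)).differentiableAt (by simp)

lemma matDiffAt_jac (h : IsometryOn U₁ U₂ G₁ G₂ ψ) (hx : x ∈ U₁) : MatDiffAt (jac ψ) x :=
  fun b i => differentiableAt_of_smooth h.source.isOpen
    (contDiffOn_pd h.source.isOpen (h.smooth_coord b) i) hx

/-- The pullback relation makes det J a factor of the nonzero determinant of the source metric, so ψ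
need not be assumed invertible. -/
lemma det_jac_ne (h : IsometryOn U₁ U₂ G₁ G₂ ψ) (hx : x ∈ U₁) : (jac ψ x).det ≠ 0 := by
  intro h0
  apply h.source.det_ne x hx
  rw [h.pullback x hx, Matrix.det_mul, h0, mul_zero]

/-- The pulled back connection matrices `∂_i ψ^b Γ_b`. -/
def pullConn (G : E4 → Matrix (Fin 4) (Fin 4) ℝ) (ψ : E4 → E4) (i : Fin 4) (x : E4) :
    Matrix (Fin 4) (Fin 4) ℝ :=
  ∑ b, jac ψ x b i • conn G b (ψ x)

lemma matDiffAt_comp_conn (h : IsometryOn U₁ U₂ G₁ G₂ ψ) (hx : x ∈ U₁) (b : Fin 4) :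
    MatDiffAt (fun y => conn G₂ b (ψ y)) x := fun a c =>
  DifferentiableAt.comp (g := fun y => conn G₂ b y a c) x (h.target.matDiffAt_conn (h.maps hx) b a c) (h.diff hx)

lemma matDiffAt_pullConn (h : IsometryOn U₁ U₂ G₁ G₂ ψ) (hx : x ∈ U₁) (i : Fin 4) :
    MatDiffAt (pullConn G₂ ψ i) x :=
  MatDiffAt.sum_smul (fun b => h.matDiffAt_jac hx b i) fun b => h.matDiffAt_comp_conn hx b

lemma pd_jac_symm (h : IsometryOn U₁ U₂ G₁ G₂ ψ) (hx : x ∈ U₁) (b i j : Fin 4) :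
    pd (fun y => jac ψ y b i) j x = pd (fun y => jac ψ y b j) i x :=
  pd_comm h.source.isOpen (h.smooth_coord b) hx i j

/-- Product rule for Jᵀ (g₂ ∘ ψ) J together with the covariant constancy of g₂. It says that J⁻¹
(∂_i J + `pullConn` J) preserves the source metric. -/
lemma pdMat_source (h : IsometryOn U₁ U₂ G₁ G₂ ψ) (hx : x ∈ U₁) (i : Fin 4) :
    pdMat G₁ i x =
      (pdMat (jac ψ) i x + pullConn G₂ ψ i x * jac ψ x).transpose * G₂ (ψ x) * jac ψ x
      + (jac ψ x).transpose * G₂ (ψ x) *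
        (pdMat (jac ψ) i x + pullConn G₂ ψ i x * jac ψ x) := by
  have hJ := h.matDiffAt_jac hx
  have hG : MatDiffAt (fun y => G₂ (ψ y)) x := fun a c =>
    DifferentiableAt.comp (g := fun y => G₂ y a c) x (h.target.diff (h.maps hx) a c) (h.diff hx)
  have hT : MatDiffAt (fun y => (jac ψ y).transpose) x := fun a b => hJ b a
  have e : pdMat (fun y => G₂ (ψ y)) i x
      = (pullConn G₂ ψ i x).transpose * G₂ (ψ x) + G₂ (ψ x) * pullConn G₂ ψ i x := by
    rw [pdMat_comp (h.diff hx) (h.target.matDiffAt (h.maps hx))]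
    simp only [h.target.pdMat_metric (h.maps hx), pullConn, Matrix.transpose_sum, Finset.sum_mul,
      Finset.mul_sum, smul_add, Finset.sum_add_distrib, Matrix.transpose_smul, Matrix.smul_mul,
      Matrix.mul_smul]
    rfl
  rw [pdMat_congr_on h.source.isOpen h.pullback hx, pdMat_mul (hT.mul hG) hJ, pdMat_mul hT hG, e,
    pdMat_transpose]
  simp only [Matrix.transpose_add, Matrix.transpose_mul]
  noncomm_ring

/-- The transformation law of the Christoffel symbols. -/
lemma jac_mul_conn (h : IsometryOn U₁ U₂ G₁ G₂ ψ) (hx : x ∈ U₁) (i : Fin 4) :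
    jac ψ x * conn G₁ i x = pdMat (jac ψ) i x + pullConn G₂ ψ i x * jac ψ x := by
  -- J⁻¹ H is symmetric in its lower indices, because mixed partials of ψ commute, and it preserves
  -- the source metric, so `eq_christoffel` identifies it with the Christoffel symbols. No
  -- derivative of J⁻¹ has to be computed.
  set H : Fin 4 → Matrix (Fin 4) (Fin 4) ℝ :=
    fun i => pdMat (jac ψ) i x + pullConn G₂ ψ i x * jac ψ x with hH
  have hu := (h.det_jac_ne hx).isUnit
  have hsymm : ∀ d a b, H a d b = H b d a := by
    intro d a b
    simp only [hH, Matrix.add_apply, pdMat, Matrix.of_apply, Matrix.mul_apply, pullConn,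
      Matrix.sum_apply, Matrix.smul_apply, smul_eq_mul, Finset.sum_mul]
    rw [h.pd_jac_symm hx, Finset.sum_comm]
    congr 1
    refine Finset.sum_congr rfl fun e _ => Finset.sum_congr rfl fun c _ => ?_
    simp only [conn, Matrix.of_apply]
    rw [h.target.christoffel_symm (h.maps hx) d e c]
    ring
  have key : ∀ c a b, christoffel G₁ c a b x = ((jac ψ x)⁻¹ * H a) c b := by
    refine h.source.eq_christoffel hx ?_ ?_
    · intro c a b
      simp only [Matrix.mul_apply, hsymm _ a b]
    · intro c a b
      have e : G₁ x * ((jac ψ x)⁻¹ * H c) = (jac ψ x).transpose * G₂ (ψ x) * H c := by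
        rw [h.pullback x hx, Matrix.mul_assoc, ← Matrix.mul_assoc (jac ψ x),
          Matrix.mul_nonsing_inv _ hu, Matrix.one_mul]
      have e1 (a b : Fin 4) : ∑ d, G₁ x b d * ((jac ψ x)⁻¹ * H c) d a
          = ((jac ψ x).transpose * G₂ (ψ x) * H c) b a := by
        rw [← e, Matrix.mul_apply]
      have e2 := congrFun (congrFun (h.pdMat_source hx c) a) b
      have e3 : (H c).transpose * G₂ (ψ x) * jac ψ x
          = ((jac ψ x).transpose * G₂ (ψ x) * H c).transpose := by
        simp only [Matrix.transpose_mul, Matrix.transpose_transpose,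
          h.target.transpose_eq (h.maps hx), Matrix.mul_assoc]
      rw [e1, e1]
      change pd _ _ _ = _ at e2
      rw [e2]
      change ((H c).transpose * G₂ (ψ x) * jac ψ x + _) a b = _
      rw [e3]
      rfl
  have : conn G₁ i x = (jac ψ x)⁻¹ * H i := by
    ext c b; exact key c i b
  rw [this, ← Matrix.mul_assoc, Matrix.mul_nonsing_inv _ hu, Matrix.one_mul]

/-- Gauge covariance of curvature. Differentiate J A_i = ∂_i J + B_i J in direction k and
antisymmetrise: the second derivatives of J drop out, and eliminating the first ones by the same law
leaves matrix algebra. -/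
lemma jac_mul_curv (h : IsometryOn U₁ U₂ G₁ G₂ ψ) (hx : x ∈ U₁) (k i : Fin 4) :
    jac ψ x * curv (conn G₁) k i x = curv (pullConn G₂ ψ) k i x * jac ψ x := by
  have hJ := h.matDiffAt_jac hx
  have hd (i k : Fin 4) : pdMat (jac ψ) k x * conn G₁ i x + jac ψ x * pdMat (conn G₁ i) k x
      = pdMat (pdMat (jac ψ) i) k x + (pdMat (pullConn G₂ ψ i) k x * jac ψ x
        + pullConn G₂ ψ i x * pdMat (jac ψ) k x) := by
    have h2 : MatDiffAt (pdMat (jac ψ) i) x := fun b c =>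
      differentiableAt_of_smooth h.source.isOpen (contDiffOn_pd h.source.isOpen
        (contDiffOn_pd h.source.isOpen (h.smooth_coord b) c) i) hx
    rw [← pdMat_mul hJ (h.source.matDiffAt_conn hx i), ← pdMat_mul (h.matDiffAt_pullConn hx i) hJ,
      ← pdMat_add h2 ((h.matDiffAt_pullConn hx i).mul hJ)]
    exact pdMat_congr_on h.source.isOpen (fun y hy => h.jac_mul_conn hy i) hx k
  have hs : pdMat (pdMat (jac ψ) i) k x = pdMat (pdMat (jac ψ) k) i x := by
    ext b c
    exact pd_comm h.source.isOpen (contDiffOn_pd h.source.isOpen (h.smooth_coord b) c) hx i k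
  have hk := h.jac_mul_conn hx k
  have hi := h.jac_mul_conn hx i
  have d1 := hd i k
  have d2 := hd k i
  rw [hs] at d1
  rw [← sub_eq_iff_eq_add] at hk hi
  rw [← hk] at d1
  rw [← hi] at d2
  simp only [curv]
  have d3 := congrArg₂ (· - ·) d1 d2
  rw [← sub_eq_zero] at d3 ⊢
  rw [← d3]
  noncomm_ring

/-- Curvature commutes with pullback of the connection form: the only obstruction is the term with
∂_k ∂_i ψ, which is symmetric and cancels. -/
lemma curv_pullConn (h : IsometryOn U₁ U₂ G₁ G₂ ψ) (hx : x ∈ U₁) (k i : Fin 4) :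
    curv (pullConn G₂ ψ) k i x
      = ∑ b, ∑ c, (jac ψ x b k * jac ψ x c i) • curv (conn G₂) b c (ψ x) := by
  have hp (i k : Fin 4) : pdMat (pullConn G₂ ψ i) k x
      = ∑ b, pd (fun y => jac ψ y b i) k x • conn G₂ b (ψ x)
        + ∑ b, ∑ c, (jac ψ x b k * jac ψ x c i) • pdMat (conn G₂ c) b (ψ x) := by
    rw [show pullConn G₂ ψ i = fun y => ∑ b, jac ψ y b i • conn G₂ b (ψ y) from rfl,
      pdMat_sum_smul (fun b => h.matDiffAt_jac hx b i) fun b => h.matDiffAt_comp_conn hx b,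
      Finset.sum_add_distrib]
    congr 1
    rw [Finset.sum_comm]
    refine Finset.sum_congr rfl fun c _ => ?_
    rw [pdMat_comp (h.diff hx) (h.target.matDiffAt_conn (h.maps hx) c), Finset.smul_sum]
    refine Finset.sum_congr rfl fun b _ => ?_
    rw [smul_smul, mul_comm]
    rfl
  have hm (i k : Fin 4) : pullConn G₂ ψ k x * pullConn G₂ ψ i x
      = ∑ b, ∑ c, (jac ψ x b k * jac ψ x c i) • (conn G₂ b (ψ x) * conn G₂ c (ψ x)) := by
    simp only [pullConn, Finset.sum_mul, Finset.mul_sum, Matrix.smul_mul, Matrix.mul_smul,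
      smul_smul]
    rw [Finset.sum_comm]
    exact Finset.sum_congr rfl fun b _ => Finset.sum_congr rfl fun c _ => by rw [mul_comm]
  have hsw (F : Fin 4 → Fin 4 → Matrix (Fin 4) (Fin 4) ℝ) :
      ∑ b, ∑ c, (jac ψ x b i * jac ψ x c k) • F b c
        = ∑ b, ∑ c, (jac ψ x b k * jac ψ x c i) • F c b := by
    rw [Finset.sum_comm]
    simp only [mul_comm]
  simp only [curv, smul_add, smul_sub, Finset.sum_add_distrib, Finset.sum_sub_distrib]
  rw [hp i k, hp k i, hm i k, hm k i, hsw, hsw]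
  simp only [h.pd_jac_symm hx _ i k]
  abel

/-- The contraction that turns curvature into Ricci: the J on the form index meets the J⁻¹ that
conjugates the upper index, and they cancel. -/
lemma sum_inv_mul_sum_smul {J : Matrix (Fin 4) (Fin 4) ℝ} (hJ : IsUnit J.det)
    (N : Fin 4 → Matrix (Fin 4) (Fin 4) ℝ) (e : Fin 4) :
    ∑ k, (J⁻¹ * ∑ b, J b k • N b) k e = ∑ b, N b b e := by
  have hI (b d : Fin 4) : ∑ k, J b k * J⁻¹ k d = if b = d then 1 else 0 := by
    rw [← Matrix.mul_apply, Matrix.mul_nonsing_inv _ hJ, Matrix.one_apply]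
  calc _ = ∑ b, ∑ d, (∑ k, J b k * J⁻¹ k d) * N b d e := by
        simp only [Matrix.mul_apply, Matrix.sum_apply, Matrix.smul_apply, smul_eq_mul,
          Finset.mul_sum, Finset.sum_mul]
        rw [Finset.sum_congr rfl fun k _ => Finset.sum_comm, Finset.sum_comm]
        refine Finset.sum_congr rfl fun b _ => ?_
        rw [Finset.sum_comm]
        exact Finset.sum_congr rfl fun d _ => Finset.sum_congr rfl fun k _ => by ring
    _ = _ := by simp [hI]

/-- The transformation law of the Ricci tensor. -/
lemma ricci_eq (h : IsometryOn U₁ U₂ G₁ G₂ ψ) (hx : x ∈ U₁) :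
    ricci G₁ x = (jac ψ x).transpose * ricci G₂ (ψ x) * jac ψ x := by
  have hu := (h.det_jac_ne hx).isUnit
  have hc (k i : Fin 4) : curv (conn G₁) k i x = (jac ψ x)⁻¹ *
      (∑ b, ∑ c, (jac ψ x b k * jac ψ x c i) • curv (conn G₂) b c (ψ x)) * jac ψ x := by
    rw [← h.curv_pullConn hx, Matrix.mul_assoc, ← h.jac_mul_curv hx, ← Matrix.mul_assoc,
      Matrix.nonsing_inv_mul _ hu, Matrix.one_mul]
  ext a i
  rw [h.source.ricci_eq_curv hx]
  have hc' (k : Fin 4) : curv (conn G₁) k i x k a = ∑ e, ((jac ψ x)⁻¹ *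
      ∑ b, jac ψ x b k • ∑ c, jac ψ x c i • curv (conn G₂) b c (ψ x)) k e * jac ψ x e a := by
    rw [hc, Matrix.mul_apply]
    simp only [Finset.smul_sum, smul_smul]
  simp only [hc']
  rw [Finset.sum_comm]
  simp only [← Finset.sum_mul, sum_inv_mul_sum_smul hu]
  simp only [Matrix.mul_apply, Matrix.transpose_apply,
    Matrix.sum_apply, Matrix.smul_apply, smul_eq_mul, h.target.ricci_eq_curv (h.maps hx)]
  simp only [Finset.sum_mul, Finset.mul_sum]
  rw [Finset.sum_congr rfl fun e _ => Finset.sum_comm, Finset.sum_comm]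
  exact Finset.sum_congr rfl fun c _ => Finset.sum_congr rfl fun e _ =>
    Finset.sum_congr rfl fun b _ => by ring

lemma trace_eq_trace (G : E4 → Matrix (Fin 4) (Fin 4) ℝ) (S : Matrix (Fin 4) (Fin 4) ℝ) (x : E4) :
    trace G S x = ((G x)⁻¹ * S.transpose).trace := by
  simp [trace, Matrix.trace, Matrix.mul_apply]

lemma scalar_eq (h : IsometryOn U₁ U₂ G₁ G₂ ψ) (hx : x ∈ U₁) :
    trace G₁ (ricci G₁ x) x = trace G₂ (ricci G₂ (ψ x)) (ψ x) := by
  have hu := (h.det_jac_ne hx).isUnit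
  have hut : IsUnit (jac ψ x).transpose.det := by rwa [Matrix.det_transpose]
  rw [trace_eq_trace, trace_eq_trace, h.ricci_eq hx, h.pullback x hx]
  simp only [Matrix.mul_inv_rev, Matrix.transpose_mul, Matrix.transpose_transpose]
  have e : (jac ψ x)⁻¹ * ((G₂ (ψ x))⁻¹ * (jac ψ x).transpose⁻¹) *
      ((jac ψ x).transpose * ((ricci G₂ (ψ x)).transpose * jac ψ x))
      = (jac ψ x)⁻¹ * ((G₂ (ψ x))⁻¹ * (ricci G₂ (ψ x)).transpose) * jac ψ x := by
    simp only [Matrix.mul_assoc]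
    rw [← Matrix.mul_assoc _ (jac ψ x).transpose, Matrix.nonsing_inv_mul _ hut, Matrix.one_mul]
  rw [e, Matrix.trace_mul_cycle, Matrix.mul_nonsing_inv _ hu, Matrix.one_mul]

end IsometryOn

end

/-! ### The Raychaudhuri equation -/

section Algebra

variable {ι : Type*} [Fintype ι]

lemma sum_rotate (F : ι → ι → ι → ℝ) :
    ∑ a, ∑ b, ∑ c, F a b c = ∑ b, ∑ c, ∑ a, F a b c := by
  rw [Finset.sum_comm]
  exact Finset.sum_congr rfl fun b _ => Finset.sum_comm

lemma sum_swap_pairs (F : ι → ι → ι → ι → ℝ) :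
    ∑ a, ∑ b, ∑ c, ∑ d, F a b c d = ∑ c, ∑ d, ∑ a, ∑ b, F a b c d := by
  rw [Finset.sum_congr rfl fun a _ => sum_rotate (F a), sum_rotate]

/-- The index computation behind the Raychaudhuri equation: `N`, `dN`, `ddN`, `Γ`, `dΓ` stand for
`N^a`, `∂_a N^b`, `∂_a ∂_b N^c`, `Γ^c_{ab}`, `∂_e Γ^c_{ab}`. -/
lemma raychaudhuri_algebra (N : ι → ℝ) (dN : ι → ι → ℝ) (ddN Γ : ι → ι → ι → ℝ)
    (dΓ : ι → ι → ι → ι → ℝ) (hdd : ∀ a b c, ddN a b c = ddN b a c)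
    (hΓ : ∀ c a b, Γ c a b = Γ c b a) (hdΓ : ∀ e c a b, dΓ e c a b = dΓ e c b a)
    (hacc : ∀ b, ∑ c, N c * (dN c b + ∑ d, Γ b c d * N d) = 0)
    (hdacc : ∀ b, ∑ c, (dN b c * (dN c b + ∑ d, Γ b c d * N d)
      + N c * (ddN b c b + ∑ d, (dΓ b b c d * N d + Γ b c d * dN b d))) = 0) :
    ∑ c, N c * ∑ a, (ddN c a a + ∑ d, (dΓ c a a d * N d + Γ a a d * dN c d))
      = -(∑ a, ∑ c, (dN a c + ∑ d, Γ c a d * N d) * (dN c a + ∑ d, Γ a c d * N d))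
        - ∑ a, ∑ b, ((∑ c, (dΓ c c a b - dΓ b c a c))
          + ∑ c, ∑ d, (Γ c c d * Γ d a b - Γ c b d * Γ d a c)) * N a * N b := by
  -- `B c a` is ∇_c N^a. The identity proved is N^c ∇_c ∇_a N^a = ∇_a (N^c ∇_c N^a) - ∇_a N^c ∇_c
  -- N^a - R_ab N^a N^b with vanishing acceleration, written in partial derivatives.
  set B : ι → ι → ℝ := fun c a => dN c a + ∑ d, Γ a c d * N d with hB
  have hL : ∑ c, N c * ∑ a, (ddN c a a + ∑ d, (dΓ c a a d * N d + Γ a a d * dN c d))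
      = ∑ a, ∑ c, N c * ddN a c a + ∑ a, ∑ c, ∑ d, N c * (dΓ c a a d * N d)
        + ∑ a, ∑ c, ∑ d, N c * (Γ a a d * dN c d) := by
    simp only [Finset.mul_sum, mul_add, Finset.sum_add_distrib]
    rw [Finset.sum_comm, Finset.sum_comm (f := fun c a => ∑ d, N c * (dΓ c a a d * N d)),
      Finset.sum_comm (f := fun c a => ∑ d, N c * (Γ a a d * dN c d)), add_assoc]
    simp only [hdd]
  -- The trace of the differentiated geodesic equation. It trades the second derivatives of N for
  -- terms quadratic in first derivatives and terms in ∂Γ.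
  have hD : ∑ a, ∑ c, dN a c * B c a + ∑ a, ∑ c, N c * ddN a c a
      + ∑ a, ∑ c, ∑ d, N c * (dΓ a a c d * N d) + ∑ a, ∑ c, ∑ d, N c * (Γ a c d * dN a d) = 0 := by
    have := Finset.sum_eq_zero fun b (_ : b ∈ Finset.univ) => hdacc b
    simp only [Finset.mul_sum, mul_add, Finset.sum_add_distrib] at this
    simp only [hB, Finset.mul_sum, mul_add, Finset.sum_add_distrib]
    linarith
  have hBB : ∑ a, ∑ c, B a c * B c a = ∑ a, ∑ c, dN a c * B c a
      + ∑ a, ∑ c, ∑ d, N c * (Γ a c d * dN a d)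
      + ∑ a, ∑ c, ∑ d, Γ c a d * N d * ∑ e, Γ a c e * N e := by
    have h1 (a c : ι) : B a c * B c a = dN a c * B c a + ∑ d, Γ c a d * N d * dN c a
        + ∑ d, Γ c a d * N d * ∑ e, Γ a c e * N e := by
      rw [← Finset.sum_mul, ← Finset.sum_mul]
      simp only [hB]
      ring
    simp only [h1, Finset.sum_add_distrib]
    congr 2
    rw [sum_rotate]
    refine Finset.sum_congr rfl fun a _ => Finset.sum_congr rfl fun c _ =>
      Finset.sum_congr rfl fun d _ => ?_
    rw [hΓ]
    ring
  have hR : ∑ a, ∑ b, ((∑ c, (dΓ c c a b - dΓ b c a c))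
          + ∑ c, ∑ d, (Γ c c d * Γ d a b - Γ c b d * Γ d a c)) * N a * N b
      = ∑ a, ∑ c, ∑ d, N c * (dΓ a a c d * N d) - ∑ a, ∑ c, ∑ d, N c * (dΓ c a a d * N d)
        + ∑ d, (∑ a, Γ a a d) * ∑ c, N c * ∑ e, Γ d c e * N e
        - ∑ a, ∑ c, ∑ d, Γ c a d * N d * ∑ e, Γ a c e * N e := by
    have h1 (a b : ι) : ((∑ c, (dΓ c c a b - dΓ b c a c))
          + ∑ c, ∑ d, (Γ c c d * Γ d a b - Γ c b d * Γ d a c)) * N a * N b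
        = ∑ c, N a * (dΓ c c a b * N b) - ∑ c, N b * (dΓ b c c a * N a)
        + ∑ c, ∑ d, Γ c c d * Γ d a b * N a * N b - ∑ c, ∑ d, Γ c b d * N b * (Γ d a c * N a) := by
      simp only [add_mul, Finset.sum_mul, Finset.sum_sub_distrib, sub_mul, hdΓ b _ a]
      have e1 : ∑ c, dΓ c c a b * N a * N b = ∑ c, N a * (dΓ c c a b * N b) :=
        Finset.sum_congr rfl fun c _ => by ring
      have e2 : ∑ c, dΓ b c c a * N a * N b = ∑ c, N b * (dΓ b c c a * N a) :=
        Finset.sum_congr rfl fun c _ => by ring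
      have e3 : ∑ c, ∑ d, Γ c b d * Γ d a c * N a * N b
          = ∑ c, ∑ d, Γ c b d * N b * (Γ d a c * N a) :=
        Finset.sum_congr rfl fun c _ => Finset.sum_congr rfl fun d _ => by ring
      rw [e1, e2, e3]
      ring
    rw [Finset.sum_congr rfl fun a _ => Finset.sum_congr rfl fun b _ => h1 a b]
    simp only [Finset.sum_add_distrib, Finset.sum_sub_distrib]
    have t1 : ∑ a, ∑ b, ∑ c, N a * (dΓ c c a b * N b)
        = ∑ a, ∑ c, ∑ d, N c * (dΓ a a c d * N d) :=
      (sum_rotate fun c a b => N a * (dΓ c c a b * N b)).symm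
    have t2 : ∑ a, ∑ b, ∑ c, N b * (dΓ b c c a * N a)
        = ∑ a, ∑ c, ∑ d, N c * (dΓ c a a d * N d) := by
      rw [Finset.sum_comm]
      exact (sum_rotate fun c b a => N b * (dΓ b c c a * N a)).symm
    have t3 : ∑ a, ∑ b, ∑ c, ∑ d, Γ c c d * Γ d a b * N a * N b
        = ∑ d, (∑ a, Γ a a d) * ∑ c, N c * ∑ e, Γ d c e * N e := by
      rw [sum_swap_pairs, Finset.sum_comm]
      refine Finset.sum_congr rfl fun d _ => ?_
      rw [Finset.sum_mul]
      refine Finset.sum_congr rfl fun c _ => ?_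
      simp only [Finset.mul_sum]
      exact Finset.sum_congr rfl fun a _ => Finset.sum_congr rfl fun b _ => by ring
    have t4 : ∑ a, ∑ b, ∑ c, ∑ d, Γ c b d * N b * (Γ d a c * N a)
        = ∑ a, ∑ c, ∑ d, Γ c a d * N d * ∑ e, Γ a c e * N e := by
      rw [sum_swap_pairs, Finset.sum_comm]
      refine Finset.sum_congr rfl fun d _ => Finset.sum_congr rfl fun c _ => ?_
      rw [Finset.sum_comm]
      refine Finset.sum_congr rfl fun b _ => ?_
      rw [Finset.mul_sum]
      exact Finset.sum_congr rfl fun a _ => by rw [hΓ c b d, hΓ d a c]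
    rw [t1, t2, t3, t4]
  -- All terms carrying the contracted symbol Γ^a_{ad} combine into its product with the
  -- acceleration, which vanishes.
  have hA : ∑ a, ∑ c, ∑ d, N c * (Γ a a d * dN c d)
      + ∑ d, (∑ a, Γ a a d) * ∑ c, N c * ∑ e, Γ d c e * N e = 0 := by
    have h0 : ∑ d, (∑ a, Γ a a d) * ∑ c, N c * B c d = 0 := by simp [hB, hacc]
    rw [← h0]
    simp only [hB, mul_add, Finset.sum_add_distrib]
    congr 1
    rw [← sum_rotate fun d a c => N c * (Γ a a d * dN c d)]
    refine Finset.sum_congr rfl fun d _ => ?_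
    rw [Finset.sum_mul]
    refine Finset.sum_congr rfl fun a _ => ?_
    rw [Finset.mul_sum]
    exact Finset.sum_congr rfl fun c _ => by ring
  rw [hL, hR]
  change _ = -(∑ a, ∑ c, B a c * B c a) - _
  rw [hBB]
  linarith

end Algebra

/-! ### Unit fields with closed covector -/

section

/-- A smooth unit timelike vector field `N` on `U` whose covector field is closed. -/
structure ClosedUnitOn (U : Set E4) (G : E4 → Matrix (Fin 4) (Fin 4) ℝ) (N : E4 → Fin 4 → ℝ) :
    Prop where
  metric : MetricOn U G
  smooth : ∀ a, ContDiffOn ℝ ∞ (fun x => N x a) U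
  unit : ∀ x ∈ U, ∑ a, lower G N x a * N x a = -1
  closed : ∀ x ∈ U, ∀ a b, pd (fun y => lower G N y b) a x = pd (fun y => lower G N y a) b x

variable {U : Set E4} {G : E4 → Matrix (Fin 4) (Fin 4) ℝ} {N : E4 → Fin 4 → ℝ} {x : E4}

lemma MetricOn.smooth_lower (h : MetricOn U G) (hN : ∀ a, ContDiffOn ℝ ∞ (fun x => N x a) U)
    (b : Fin 4) : ContDiffOn ℝ ∞ (fun x => lower G N x b) U :=
  ContDiffOn.sum fun a _ => (h.smooth a b).mul (hN a)

/-- Lowering an index commutes with ∇, since the metric is covariantly constant. -/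
lemma MetricOn.nablaCovector_lower (h : MetricOn U G)
    (hN : ∀ a, ContDiffOn ℝ ∞ (fun x => N x a) U) (hx : x ∈ U) (a b : Fin 4) :
    nablaCovector G (lower G N) a b x = ∑ c, G x b c * nablaVector G N a c x := by
  have hN' (c : Fin 4) := differentiableAt_of_smooth h.isOpen (hN c) hx
  have e : pd (fun y => lower G N y b) a x = ∑ c, (pd (fun y => G y c b) a x * N x c
      + G x c b * pd (fun y => N y c) a x) := by
    unfold lower
    rw [pd_sum _ (u := fun c y => G y c b * N y c) fun c _ => (h.diff hx c b).mul (hN' c)]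
    exact Finset.sum_congr rfl fun c _ => pd_mul (h.diff hx c b) (hN' c) a
  have e1 : ∑ c, christoffel G c a b x * lower G N x c
      = ∑ c, (∑ d, G x c d * christoffel G d a b x) * N x c := by
    simp only [lower, Finset.mul_sum, Finset.sum_mul]
    rw [Finset.sum_comm]
    exact Finset.sum_congr rfl fun c _ => Finset.sum_congr rfl fun d _ => by
      ring
  have e2 : ∑ c, (∑ d, G x b d * christoffel G d a c x) * N x c
      = ∑ d, G x b d * ∑ c, christoffel G d a c x * N x c := by
    simp only [Finset.mul_sum, Finset.sum_mul]
    rw [Finset.sum_comm]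
    exact Finset.sum_congr rfl fun c _ => Finset.sum_congr rfl fun d _ => by
      ring
  simp only [nablaCovector, nablaVector]
  rw [e, e1]
  simp only [h.pd_metric hx, add_mul, mul_add, Finset.sum_add_distrib]
  rw [e2]
  simp only [h.symm x hx b]
  ring

namespace ClosedUnitOn

lemma diff (h : ClosedUnitOn U G N) (hx : x ∈ U) (a : Fin 4) :
    DifferentiableAt ℝ (fun x => N x a) x :=
  differentiableAt_of_smooth h.metric.isOpen (h.smooth a) hx

lemma diff_lower (h : ClosedUnitOn U G N) (hx : x ∈ U) (a : Fin 4) :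
    DifferentiableAt ℝ (fun x => lower G N x a) x :=
  differentiableAt_of_smooth h.metric.isOpen (h.metric.smooth_lower h.smooth a) hx

lemma nablaCovector_symm (h : ClosedUnitOn U G N) (hx : x ∈ U) (a b : Fin 4) :
    nablaCovector G (lower G N) a b x = nablaCovector G (lower G N) b a x := by
  unfold nablaCovector
  rw [h.closed x hx a b]
  congr 1
  exact Finset.sum_congr rfl fun c _ => by rw [h.metric.christoffel_symm hx]

/-- The derivative of n_b n^b = -1 consists of two product-rule terms, which are equal by metric
compatibility, so each vanishes. -/
lemma sum_lower_mul_nablaVector (h : ClosedUnitOn U G N) (hx : x ∈ U) (a : Fin 4) :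
    ∑ b, lower G N x b * nablaVector G N a b x = 0 := by
  have e : pd (fun y => ∑ b, lower G N y b * N y b) a x = 0 := by
    rw [pd_congr_on h.metric.isOpen h.unit hx]; simp
  rw [pd_sum _ (u := fun b y => lower G N y b * N y b)
      fun b _ => (h.diff_lower hx b).mul (h.diff hx b),
    Finset.sum_congr rfl fun b _ => pd_mul (h.diff_lower hx b) (h.diff hx b) a] at e
  have e1 : ∑ b, nablaCovector G (lower G N) a b x * N x b
      = ∑ b, lower G N x b * nablaVector G N a b x := by
    simp only [h.metric.nablaCovector_lower h.smooth hx, lower, Finset.sum_mul]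
    rw [Finset.sum_comm]
    exact Finset.sum_congr rfl fun c _ => Finset.sum_congr rfl fun d _ => by ring
  have e2 : ∑ b, nablaCovector G (lower G N) a b x * N x b
      + ∑ b, lower G N x b * nablaVector G N a b x = 0 := by
    rw [← e]
    simp only [nablaCovector, nablaVector, sub_mul, mul_add, Finset.sum_add_distrib,
      Finset.sum_sub_distrib, Finset.mul_sum, Finset.sum_mul]
    rw [Finset.sum_comm (f := fun b c => lower G N x b * (christoffel G b a c x * N x c))]
    have : ∑ b, ∑ c, christoffel G c a b x * lower G N x c * N x b
      = ∑ b, ∑ c, lower G N x c * (christoffel G c a b x * N x b) :=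
      Finset.sum_congr rfl fun c _ => Finset.sum_congr rfl fun d _ => by ring
    rw [this]
    ring
  linarith

lemma sum_nablaCovector_mul (h : ClosedUnitOn U G N) (hx : x ∈ U) (a : Fin 4) :
    ∑ b, nablaCovector G (lower G N) a b x * N x b = 0 := by
  rw [← h.sum_lower_mul_nablaVector hx a]
  simp only [h.metric.nablaCovector_lower h.smooth hx, lower, Finset.sum_mul]
  rw [Finset.sum_comm]
  exact Finset.sum_congr rfl fun c _ => Finset.sum_congr rfl fun d _ => by ring

/-- The integral curves are geodesics. -/
lemma acceleration_eq_zero (h : ClosedUnitOn U G N) (hx : x ∈ U) (b : Fin 4) :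
    acceleration G N x b = 0 := by
  have e : (G x).mulVec (acceleration G N x) = 0 := by
    funext b
    have := h.sum_nablaCovector_mul hx b
    -- Closedness lets the two indices be exchanged, so n^a ∇_a n_b becomes n^a ∇_b n_a, which is
    -- zero for a unit field.
    simp only [h.nablaCovector_symm hx b, h.metric.nablaCovector_lower h.smooth hx] at this
    rw [Pi.zero_apply, ← this]
    simp only [Matrix.mulVec, dotProduct, acceleration, Finset.mul_sum, Finset.sum_mul]
    rw [Finset.sum_comm]
    exact Finset.sum_congr rfl fun c _ => Finset.sum_congr rfl fun d _ => by ring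
  have := congrArg ((G x)⁻¹).mulVec e
  rw [Matrix.mulVec_mulVec, h.metric.inv_mul hx, Matrix.one_mulVec, Matrix.mulVec_zero] at this
  exact congrFun this b

/-- The gradient is already symmetric and annihilates n in each slot, so neither the symmetrisation
nor the projections change it. -/
lemma extrinsic_eq (h : ClosedUnitOn U G N) (hx : x ∈ U) (a b : Fin 4) :
    extrinsic G N a b x = nablaCovector G (lower G N) a b x := by
  have h1 (c : Fin 4) : ∑ d, projection G N x b d * nablaCovector G (lower G N) c d x
      = nablaCovector G (lower G N) c b x := by
    simp only [projection, add_mul, Finset.sum_add_distrib, ite_mul, one_mul, zero_mul,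
      Finset.sum_ite_eq, Finset.mem_univ, if_true]
    have : ∑ d, lower G N x b * N x d * nablaCovector G (lower G N) c d x
        = lower G N x b * ∑ d, nablaCovector G (lower G N) c d x * N x d := by
      rw [Finset.mul_sum]
      exact Finset.sum_congr rfl fun d _ => by ring
    rw [this, h.sum_nablaCovector_mul hx]
    ring
  have h2 : ∑ c, projection G N x a c * nablaCovector G (lower G N) b c x
      = nablaCovector G (lower G N) b a x := by
    simp only [projection, add_mul, Finset.sum_add_distrib, ite_mul, one_mul, zero_mul,
      Finset.sum_ite_eq, Finset.mem_univ, if_true]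
    have : ∑ d, lower G N x a * N x d * nablaCovector G (lower G N) b d x
        = lower G N x a * ∑ d, nablaCovector G (lower G N) b d x * N x d := by
      rw [Finset.mul_sum]
      exact Finset.sum_congr rfl fun d _ => by ring
    rw [this, h.sum_nablaCovector_mul hx]
    ring
  unfold extrinsic
  have h3 (c : Fin 4) : ∑ d, projection G N x a c * projection G N x b d *
      ((1 / 2) * (nablaCovector G (lower G N) c d x + nablaCovector G (lower G N) d c x))
      = projection G N x a c * nablaCovector G (lower G N) b c x := by
    rw [h.nablaCovector_symm hx b c, ← h1, Finset.mul_sum]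
    exact Finset.sum_congr rfl fun d _ => by rw [h.nablaCovector_symm hx d c]; ring
  rw [Finset.sum_congr rfl fun c _ => h3 c, h2, h.nablaCovector_symm hx]

lemma expansion_eq (h : ClosedUnitOn U G N) (hx : x ∈ U) :
    expansion G N x = ∑ a, ∑ b, (G x)⁻¹ a b * nablaCovector G (lower G N) a b x := by
  unfold expansion
  have (a : Fin 4) : ∑ b, ((G x)⁻¹ a b + N x a * N x b) * extrinsic G N a b x
      = ∑ b, (G x)⁻¹ a b * nablaCovector G (lower G N) a b x
        + N x a * ∑ b, nablaCovector G (lower G N) a b x * N x b := by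
    rw [Finset.mul_sum, ← Finset.sum_add_distrib]
    exact Finset.sum_congr rfl fun b _ => by rw [h.extrinsic_eq hx]; ring
  simp only [this, h.sum_nablaCovector_mul hx, mul_zero, add_zero]

/-- The matrix `∇_a N^b`. -/
noncomputable def gradMat (G : E4 → Matrix (Fin 4) (Fin 4) ℝ) (N : E4 → Fin 4 → ℝ) (x : E4) :
    Matrix (Fin 4) (Fin 4) ℝ :=
  Matrix.of fun a b => nablaVector G N a b x

lemma of_nablaCovector (h : ClosedUnitOn U G N) (hx : x ∈ U) :
    (Matrix.of fun a b => nablaCovector G (lower G N) a b x) = G x * (gradMat G N x).transpose := by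
  ext a b
  rw [Matrix.of_apply, h.nablaCovector_symm hx, h.metric.nablaCovector_lower h.smooth hx]
  rfl

lemma expansion_eq_divergence (h : ClosedUnitOn U G N) (hx : x ∈ U) :
    expansion G N x = divergence G N x := by
  have : ∑ a, ∑ b, (G x)⁻¹ a b * nablaCovector G (lower G N) a b x
      = ((G x)⁻¹ * (Matrix.of fun a b => nablaCovector G (lower G N) a b x)).trace := by
    simp only [Matrix.trace, Matrix.diag_apply, Matrix.mul_apply, Matrix.of_apply]
    exact Finset.sum_congr rfl fun a _ => Finset.sum_congr rfl fun b _ => by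
      rw [h.nablaCovector_symm hx]
  rw [h.expansion_eq hx, this, h.of_nablaCovector hx, ← Matrix.mul_assoc, h.metric.inv_mul hx,
    Matrix.one_mul]
  simp [Matrix.trace, gradMat, divergence]

/-- With one index raised, the shear is Bᵀ - (θ/3) P, where B = ∇n and P = 1 + n ⊗ n♭ is a projector
of trace 3. Since Bᵀ n = 0, the trace of the square is tr B² - 2θ²/3 + θ²/3. -/
lemma two_mul_shearSq (h : ClosedUnitOn U G N) (hx : x ∈ U) :
    2 * shearSq G N x = ∑ a, ∑ c, nablaVector G N a c x * nablaVector G N c a x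
      - (1 / 3) * expansion G N x ^ 2 := by
  set θ := expansion G N x with hθ
  set B := gradMat G N x with hB
  set S : Matrix (Fin 4) (Fin 4) ℝ := Matrix.of fun a b => shear G N a b x with hS
  set n := lower G N x with hn
  have hBt : B.trace = θ := by
    rw [hθ, h.expansion_eq_divergence hx]; simp [Matrix.trace, hB, gradMat, divergence]
  have hnG : n = Matrix.mulVec (G x) (N x) := by
    funext b
    simp only [hn, lower, Matrix.mulVec, dotProduct]
    exact Finset.sum_congr rfl fun a _ => by rw [h.metric.symm x hx]
  have hnN : n ⬝ᵥ N x = -1 := h.unit x hx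
  have hacc : B.transpose.mulVec (N x) = 0 := by
    funext b
    rw [Pi.zero_apply, ← h.acceleration_eq_zero hx b]
    simp [Matrix.mulVec, dotProduct, acceleration, hB, gradMat, mul_comm]
  have hSm : S = G x * (B.transpose - (θ / 3) • (1 + Matrix.vecMulVec (N x) n)) := by
    rw [Matrix.mul_sub, ← h.of_nablaCovector hx, Matrix.mul_smul, Matrix.mul_add, Matrix.mul_one,
      Matrix.mul_vecMulVec, ← hnG]
    ext a b
    simp [hS, shear, h.extrinsic_eq hx, Matrix.vecMulVec_apply, ← hθ, ← hn]
    ring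
  have hSs : S.transpose = S := by
    ext a b
    simp only [hS, Matrix.transpose_apply, Matrix.of_apply, shear, h.extrinsic_eq hx]
    rw [h.nablaCovector_symm hx, h.metric.symm x hx]
    ring
  have h1 : 2 * shearSq G N x = ((G x)⁻¹ * S * ((G x)⁻¹ * S)).trace := by
    have : ((G x)⁻¹ * S * ((G x)⁻¹ * S)).trace = ((G x)⁻¹ * S * ((G x)⁻¹ * S.transpose)).trace := by
      rw [hSs]
    rw [this]
    unfold shearSq
    rw [← mul_assoc, show (2 : ℝ) * (1 / 2) = 1 by norm_num, one_mul]
    simp only [Matrix.trace, Matrix.diag_apply, Matrix.mul_apply, Matrix.transpose_apply,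
      Finset.sum_mul_sum, hS, Matrix.of_apply]
    rw [sum_rotate, Finset.sum_comm]
    exact Finset.sum_congr rfl fun c _ => Finset.sum_congr rfl fun b _ =>
      Finset.sum_congr rfl fun a _ => Finset.sum_congr rfl fun d _ => by
        rw [h.metric.inv_symm hx a c]; ring
  have h2 : (G x)⁻¹ * S = B.transpose - (θ / 3) • (1 + Matrix.vecMulVec (N x) n) := by
    rw [hSm, ← Matrix.mul_assoc, h.metric.inv_mul hx, Matrix.one_mul]
  rw [h1, h2]
  have h3 : B.transpose * Matrix.vecMulVec (N x) n = 0 := by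
    rw [Matrix.mul_vecMulVec, hacc]; simp
  have h4 : (Matrix.vecMulVec (N x) n * B.transpose).trace = 0 := by
    rw [Matrix.trace_mul_comm, h3]; simp
  have h5 : Matrix.vecMulVec (N x) n * Matrix.vecMulVec (N x) n = - Matrix.vecMulVec (N x) n := by
    rw [Matrix.vecMulVec_mul_vecMulVec, hnN]
    simp
  have h6 : (Matrix.vecMulVec (N x) n).trace = -1 := by
    rw [Matrix.trace_vecMulVec, dotProduct_comm, hnN]
  have h7 : (B.transpose * B.transpose).trace
      = ∑ a, ∑ c, nablaVector G N a c x * nablaVector G N c a x := by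
    simp only [Matrix.trace, Matrix.diag_apply, Matrix.mul_apply, Matrix.transpose_apply]
    exact Finset.sum_congr rfl fun a _ => Finset.sum_congr rfl fun c _ => mul_comm _ _
  have h8 : (B.transpose - (θ / 3) • (1 + Matrix.vecMulVec (N x) n)) *
      (B.transpose - (θ / 3) • (1 + Matrix.vecMulVec (N x) n))
      = B.transpose * B.transpose - (θ / 3) • (B.transpose + B.transpose)
        - (θ / 3) • (B.transpose * Matrix.vecMulVec (N x) n)
        - (θ / 3) • (Matrix.vecMulVec (N x) n * B.transpose)
        + (θ / 3 * (θ / 3)) • (1 + Matrix.vecMulVec (N x) n + Matrix.vecMulVec (N x) n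
          + Matrix.vecMulVec (N x) n * Matrix.vecMulVec (N x) n) := by
    simp only [Matrix.sub_mul, Matrix.mul_sub, Matrix.smul_mul, Matrix.mul_smul, Matrix.add_mul,
      Matrix.mul_add, Matrix.one_mul, Matrix.mul_one]
    module
  rw [h8, h3, h5, ← h7]
  simp only [Matrix.trace_add, Matrix.trace_sub, Matrix.trace_smul, h4, h6, Matrix.trace_neg,
    Matrix.trace_transpose, hBt, Matrix.trace_one, Matrix.trace_zero, Fintype.card_fin, smul_eq_mul]
  push_cast
  ring

lemma pd_nablaVector (h : ClosedUnitOn U G N) (hx : x ∈ U) (c a b : Fin 4) :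
    pd (nablaVector G N a b) c x = pd (pd (fun y => N y b) a) c x
      + ∑ d, (pd (christoffel G b a d) c x * N x d
        + christoffel G b a d x * pd (fun y => N y d) c x) := by
  have hU := h.metric.isOpen
  have h1 := differentiableAt_of_smooth hU (contDiffOn_pd hU (h.smooth b) a) hx
  have h2 (d : Fin 4) := differentiableAt_of_smooth hU (h.metric.smooth_christoffel b a d) hx
  have h3 : DifferentiableAt ℝ (fun y => ∑ d, christoffel G b a d y * N y d) x :=
    DifferentiableAt.fun_sum fun d _ => (h2 d).mul (h.diff hx d)
  rw [show nablaVector G N a b = fun y => pd (fun z => N z b) a y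
    + ∑ d, christoffel G b a d y * N y d from rfl, pd_add h1 h3]
  rw [pd_sum _ (u := fun d y => christoffel G b a d y * N y d) fun d _ => (h2 d).mul (h.diff hx d)]
  congr 1
  exact Finset.sum_congr rfl fun d _ => pd_mul (h2 d) (h.diff hx d) c

lemma diff_nablaVector (h : ClosedUnitOn U G N) (hx : x ∈ U) (a b : Fin 4) :
    DifferentiableAt ℝ (nablaVector G N a b) x := by
  have hU := h.metric.isOpen
  exact (differentiableAt_of_smooth hU (contDiffOn_pd hU (h.smooth b) a) hx).add
    (DifferentiableAt.fun_sum fun d _ =>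
      (differentiableAt_of_smooth hU (h.metric.smooth_christoffel b a d) hx).mul (h.diff hx d))

/-- The Raychaudhuri equation. -/
lemma raychaudhuri (h : ClosedUnitOn U G N) (hx : x ∈ U) : Raychaudhuri G N (ricci G x) x := by
  have hU := h.metric.isOpen
  -- The acceleration vanishes on an open set, so its partial derivatives vanish as well; this is
  -- the differentiated geodesic equation that the index computation needs.
  have hdacc (b : Fin 4) := pd_congr_on hU (fun y hy => h.acceleration_eq_zero hy b) hx b
  have key := raychaudhuri_algebra (N x) (fun a b => pd (fun y => N y b) a x)
    (fun a b c => pd (pd (fun y => N y c) b) a x) (fun c a b => christoffel G c a b x)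
    (fun e c a b => pd (christoffel G c a b) e x)
    (fun a b c => pd_comm hU (h.smooth c) hx b a)
    (fun c a b => h.metric.christoffel_symm hx c a b)
    (fun e c a b => h.metric.christoffel_symm_fun hx c a b e)
    (fun b => h.acceleration_eq_zero hx b) (fun b => by
      have := hdacc b
      simp only [acceleration] at this
      rw [pd_sum _ (u := fun c y => N y c * nablaVector G N c b y)
          fun c _ => (h.diff hx c).mul (h.diff_nablaVector hx c b), pd_const] at this
      rw [← this]
      refine Finset.sum_congr rfl fun c _ => ?_
      rw [pd_mul (h.diff hx c) (h.diff_nablaVector hx c b), h.pd_nablaVector hx]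
      rfl)
  have e : along N (expansion G N) x = ∑ c, N x c * ∑ a, pd (nablaVector G N a a) c x := by
    unfold along
    refine Finset.sum_congr rfl fun c _ => ?_
    rw [pd_congr_on hU (fun y hy => h.expansion_eq_divergence hy) hx]
    unfold divergence
    rw [pd_sum _ (u := fun a => nablaVector G N a a) fun a _ => h.diff_nablaVector hx a a]
  unfold Raychaudhuri
  have hs := h.two_mul_shearSq hx
  have hs' : -(1 / 3) * expansion G N x ^ 2 - 2 * shearSq G N x
      = -∑ a, ∑ c, nablaVector G N a c x * nablaVector G N c a x := by linarith
  rw [e, hs']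
  simp only [h.pd_nablaVector hx]
  exact key

lemma divergence_acceleration (h : ClosedUnitOn U G N) (hx : x ∈ U) :
    divergence G (acceleration G N) x = 0 := by
  simp only [divergence, nablaVector, h.acceleration_eq_zero hx, mul_zero, Finset.sum_const_zero,
    add_zero]
  refine Finset.sum_eq_zero fun a _ => ?_
  rw [pd_congr_on h.metric.isOpen (fun y hy => h.acceleration_eq_zero hy a) hx, pd_const]

lemma acceleratedRaychaudhuri (h : ClosedUnitOn U G N) (hx : x ∈ U) :
    AcceleratedRaychaudhuri G N x := by
  have := h.raychaudhuri hx
  unfold Raychaudhuri at this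
  rw [AcceleratedRaychaudhuri, h.divergence_acceleration hx, this, add_zero]

/-- The d'Alembertian of a function whose differential is proportional to `N`. -/
lemma box_eq (h : ClosedUnitOn U G N) {φ : E4 → ℝ} (hφ : ContDiffOn ℝ ∞ φ U)
    (hN : ∀ y ∈ U, ∀ a, pd φ a y = -(along N φ y) * lower G N y a) (hx : x ∈ U) :
    box G φ x = -(along N (along N φ) x + expansion G N x * along N φ x) := by
  have hU := h.metric.isOpen
  have hl : ContDiffOn ℝ ∞ (along N φ) U :=
    ContDiffOn.sum fun a _ => (h.smooth a).mul (contDiffOn_pd hU hφ a)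
  have hl' := differentiableAt_of_smooth hU hl hx
  -- Differentiate ∂_b φ = -φ̇ n_b covariantly. In the trace, the first term gives -φ̈ and the
  -- second -K φ̇.
  have e (a b : Fin 4) : hessian G φ x a b = -(pd (along N φ) a x) * lower G N x b
      - along N φ x * nablaCovector G (lower G N) a b x := by
    simp only [hessian, Matrix.of_apply, nablaCovector]
    rw [pd_congr_on hU (fun y hy => hN y hy b) hx, pd_mul hl'.fun_neg (h.diff_lower hx b), pd_neg]
    simp only [hN x hx, mul_sub, Finset.mul_sum]
    have : ∑ c, christoffel G c a b x * (-along N φ x * lower G N x c)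
        = -∑ c, along N φ x * (christoffel G c a b x * lower G N x c) := by
      rw [← Finset.sum_neg_distrib]
      exact Finset.sum_congr rfl fun c _ => by ring
    rw [this]
    ring
  have hr (a : Fin 4) : ∑ b, (G x)⁻¹ a b * lower G N x b = N x a := by
    have : (G x)⁻¹.mulVec ((G x).mulVec (N x)) = N x := by
      rw [Matrix.mulVec_mulVec, h.metric.inv_mul hx, Matrix.one_mulVec]
    rw [← congrFun this a]
    simp only [Matrix.mulVec, dotProduct, lower]
    exact Finset.sum_congr rfl fun b _ => by
      congr 1
      exact Finset.sum_congr rfl fun c _ => by rw [h.metric.symm x hx]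
  unfold box trace
  have e1 (a : Fin 4) : ∑ b, (G x)⁻¹ a b * hessian G φ x a b
      = -(N x a * pd (along N φ) a x)
        - along N φ x * ∑ b, (G x)⁻¹ a b * nablaCovector G (lower G N) a b x := by
    rw [← hr, Finset.mul_sum, Finset.sum_mul, ← Finset.sum_neg_distrib, ← Finset.sum_sub_distrib]
    exact Finset.sum_congr rfl fun b _ => by rw [e]; ring
  rw [Finset.sum_congr rfl fun a _ => e1 a, Finset.sum_sub_distrib, ← Finset.mul_sum,
    ← h.expansion_eq hx, Finset.sum_neg_distrib]
  rw [show along N (along N φ) x = ∑ a, N x a * pd (along N φ) a x from rfl]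
  ring

end ClosedUnitOn

end

/-! ### Conformal changes of the metric -/

section Algebra

/-- The difference of the Levi-Civita connections of `e^φ g` and `g`; here `p = ∂_a φ` and
`q = ∂^a φ`. -/
noncomputable def confDiff (g : Matrix (Fin 4) (Fin 4) ℝ) (p q : Fin 4 → ℝ)
    (c a b : Fin 4) : ℝ :=
  (1 / 2) * ((if c = a then p b else 0) + (if c = b then p a else 0) - g a b * q c)

variable {g : Matrix (Fin 4) (Fin 4) ℝ} {p q : Fin 4 → ℝ}

lemma sum_mul_confDiff (u : Fin 4 → ℝ) (a b : Fin 4) :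
    ∑ d, u d * confDiff g p q d a b
      = (1 / 2) * (u a * p b + u b * p a - g a b * ∑ d, u d * q d) := by
  have h1 : u a * p b = ∑ d, u d * (if d = a then p b else 0) := by simp
  have h2 : u b * p a = ∑ d, u d * (if d = b then p a else 0) := by simp
  rw [h1, h2, Finset.mul_sum, ← Finset.sum_add_distrib, ← Finset.sum_sub_distrib, Finset.mul_sum]
  exact Finset.sum_congr rfl fun d _ => by unfold confDiff; ring

lemma sum_confDiff_mul (v : Fin 4 → ℝ) (c b : Fin 4) :
    ∑ d, confDiff g p q c b d * v d
      = (1 / 2) * ((if c = b then ∑ d, p d * v d else 0) + p b * v c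
        - q c * ∑ d, g b d * v d) := by
  have h1 : (if c = b then ∑ d, p d * v d else 0) = ∑ d, (if c = b then p d else 0) * v d := by
    split_ifs <;> simp
  have h2 : p b * v c = ∑ d, (if c = d then p b else 0) * v d := by simp
  rw [h1, h2, Finset.mul_sum, ← Finset.sum_add_distrib, ← Finset.sum_sub_distrib, Finset.mul_sum]
  exact Finset.sum_congr rfl fun d _ => by unfold confDiff; ring

/-- The factor is half the dimension: ½ (1 + 4 - 1). -/
lemma sum_confDiff (hq : ∀ a, ∑ c, g a c * q c = p a) (a : Fin 4) :
    ∑ c, confDiff g p q c a c = 2 * p a := by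
  have h1 : ∑ c, (if c = a then p c else 0) = p a := by simp
  simp only [confDiff, ← Finset.mul_sum, Finset.sum_add_distrib, Finset.sum_sub_distrib, hq, h1]
  simp
  ring

lemma confDiff_symm (hg : ∀ a b, g a b = g b a) (c a b : Fin 4) :
    confDiff g p q c a b = confDiff g p q c b a := by
  unfold confDiff; rw [hg]; ring

/-- The index computation behind the conformal transformation of the Ricci tensor. -/
lemma conformal_ricci_algebra (Γ : Fin 4 → Fin 4 → Fin 4 → ℝ)
    (dΓ : Fin 4 → Fin 4 → Fin 4 → Fin 4 → ℝ) (dp dq : Fin 4 → Fin 4 → ℝ)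
    (dg : Fin 4 → Fin 4 → Fin 4 → ℝ) (dC : Fin 4 → Fin 4 → Fin 4 → Fin 4 → ℝ)
    (hg : ∀ a b, g a b = g b a) (hΓ : ∀ c a b, Γ c a b = Γ c b a)
    (hdp : ∀ a b, dp a b = dp b a) (hq : ∀ a, ∑ c, g a c * q c = p a)
    (hdq : ∀ b a, ∑ c, (dg b a c * q c + g a c * dq b c) = dp b a)
    (hdg : ∀ c a b, dg c a b = ∑ d, g b d * Γ d c a + ∑ d, g a d * Γ d c b)
    (hdC : ∀ e c a b, dC e c a b = (1 / 2) * ((if c = a then dp e b else 0)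
      + (if c = b then dp e a else 0) - (dg e a b * q c + g a b * dq e c)))
    (a b : Fin 4) :
    (∑ c, ((dΓ c c a b + dC c c a b) - (dΓ b c a c + dC b c a c)))
      + ∑ c, ∑ d, ((Γ c c d + confDiff g p q c c d) * (Γ d a b + confDiff g p q d a b)
        - (Γ c b d + confDiff g p q c b d) * (Γ d a c + confDiff g p q d a c))
    = (∑ c, (dΓ c c a b - dΓ b c a c)) + ∑ c, ∑ d, (Γ c c d * Γ d a b - Γ c b d * Γ d a c)
      - (dp a b - ∑ c, Γ c a b * p c) + (1 / 2) * (p a * p b)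
      - (1 / 2) * g a b * (∑ c, (dq c c + ∑ d, Γ c c d * q d) + ∑ c, p c * q c) := by
  set C := confDiff g p q with hC
  have hs := confDiff_symm (p := p) (q := q) hg
  have htr (a : Fin 4) : ∑ c, C c c a = 2 * p a := by
    rw [← sum_confDiff hq a]
    exact Finset.sum_congr rfl fun c _ => hs c c a
  have d1 : ∑ c, dC c c a b = (1 / 2) * (2 * dp a b - ∑ c, dg c a b * q c
      - g a b * ∑ c, dq c c) := by
    have e1 : ∑ c, (if c = a then dp c b else 0) = dp a b := by simp
    have e2 : ∑ c, (if c = b then dp c a else 0) = dp a b := by simp [hdp]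
    simp only [hdC, ← Finset.mul_sum, Finset.sum_add_distrib, Finset.sum_sub_distrib, e1, e2]
    ring
  have d2 : ∑ c, dC b c a c = 2 * dp a b := by
    have e1 : ∑ c, (if c = a then dp b c else 0) = dp a b := by simp [hdp]
    simp only [hdC, ← Finset.mul_sum, Finset.sum_add_distrib, Finset.sum_sub_distrib, e1]
    have := hdq b a
    rw [Finset.sum_add_distrib] at this
    rw [this, hdp b a]
    simp
    ring
  -- Expansion of (Γ + C)(Γ + C): `x1` to `x4` are the mixed terms, `y1` and `y2` those quadratic in
  -- C.
  have x1 : ∑ c, ∑ d, Γ c c d * C d a b = (1 / 2) * ((∑ c, Γ c c a) * p b + (∑ c, Γ c c b) * p a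
      - g a b * ∑ c, ∑ d, Γ c c d * q d) := by
    simp only [hC, sum_mul_confDiff, ← Finset.mul_sum, Finset.sum_add_distrib,
      Finset.sum_sub_distrib, Finset.sum_mul]
  have x2 : ∑ c, ∑ d, C c c d * Γ d a b = 2 * ∑ d, Γ d a b * p d := by
    rw [Finset.sum_comm]
    simp only [← Finset.sum_mul, htr, Finset.mul_sum]
    exact Finset.sum_congr rfl fun d _ => by ring
  have x3 : ∑ c, ∑ d, Γ c b d * C d a c = (1 / 2) * (∑ c, Γ c a b * p c + (∑ c, Γ c c b) * p a
      - ∑ d, (∑ c, g a c * Γ c d b) * q d) := by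
    simp only [hC, sum_mul_confDiff, ← Finset.mul_sum, Finset.sum_add_distrib,
      Finset.sum_sub_distrib, Finset.sum_mul, hΓ _ b _]
    rw [Finset.sum_comm (f := fun d c => g a c * Γ c d b * q d)]
    simp only [mul_assoc, Finset.mul_sum]
  have x4 : ∑ c, ∑ d, C c b d * Γ d a c = (1 / 2) * (∑ c, Γ c a b * p c + (∑ c, Γ c c a) * p b
      - ∑ d, (∑ c, g b c * Γ c d a) * q d) := by
    have e1 : ∑ c, (if c = b then ∑ d, p d * Γ d a c else 0) = ∑ c, Γ c a b * p c := by
      simp [mul_comm]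
    simp only [hC, sum_confDiff_mul, ← Finset.mul_sum, Finset.sum_add_distrib,
      Finset.sum_sub_distrib, e1]
    simp only [hΓ _ a _, mul_comm]
  have y1 : ∑ c, ∑ d, C c c d * C d a b = 2 * (p a * p b) - g a b * ∑ c, p c * q c := by
    rw [Finset.sum_comm]
    simp only [← Finset.sum_mul, htr, mul_assoc]
    rw [← Finset.mul_sum, hC, sum_mul_confDiff]
    ring
  have y2 : ∑ c, ∑ d, C c b d * C d a c = (3 / 2) * (p a * p b)
      - (1 / 2) * (g a b * ∑ c, p c * q c) := by
    have e1 (c : Fin 4) : ∑ d, g b d * C d a c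
        = (1 / 2) * (g b a * p c + g b c * p a - g a c * p b) := by
      rw [hC, sum_mul_confDiff, hq]
    have e2 : ∑ c, (if c = b then ∑ d, p d * C d a c else 0)
        = p a * p b - (1 / 2) * (g a b * ∑ c, p c * q c) := by
      simp only [Finset.sum_ite_eq', Finset.mem_univ, if_true]
      rw [hC, sum_mul_confDiff]
      ring
    have e3 : ∑ c, q c * ((1 / 2) * (g b a * p c + g b c * p a - g a c * p b))
        = (1 / 2) * (g a b * ∑ c, p c * q c) := by
      have : ∀ c, q c * ((1 / 2) * (g b a * p c + g b c * p a - g a c * p b))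
          = (1 / 2) * (g a b * (p c * q c)) + (1 / 2) * p a * (g b c * q c)
            - (1 / 2) * p b * (g a c * q c) := fun c => by rw [hg b a]; ring
      simp only [this, Finset.sum_add_distrib, Finset.sum_sub_distrib, ← Finset.mul_sum, hq]
      ring
    have e4 : ∑ c, C c a c = 2 * p a := sum_confDiff hq a
    have e5 (c : Fin 4) : ∑ d, C c b d * C d a c = (1 / 2) * ((if c = b then ∑ d, p d * C d a c
        else 0) + p b * C c a c - q c * ∑ d, g b d * C d a c) := by
      rw [hC, sum_confDiff_mul]
    simp only [e5, e1, ← Finset.mul_sum, Finset.sum_add_distrib, Finset.sum_sub_distrib, e2, e3, e4]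
    ring
  -- By metric compatibility, the ∂g terms of `d1` match the gΓ terms of `x3` and `x4` and cancel
  -- against them.
  have z : ∑ c, dg c a b * q c = ∑ d, (∑ c, g b c * Γ c d a) * q d
      + ∑ d, (∑ c, g a c * Γ c d b) * q d := by
    simp only [hdg, add_mul, Finset.sum_add_distrib]
  simp only [add_mul, mul_add, Finset.sum_add_distrib, Finset.sum_sub_distrib, x1, x2, x3, x4, y1,
    y2, d1, d2, z]
  ring

end Algebra

/-! ### Conformal change of Ricci tensor, Hessian and unit field -/

noncomputable section

/-- `∂^c φ`. -/
def grad (G : E4 → Matrix (Fin 4) (Fin 4) ℝ) (φ : E4 → ℝ) (x : E4) (c : Fin 4) : ℝ :=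
  ∑ d, (G x)⁻¹ c d * pd φ d x

/-- `(∂φ)² = g^{cd} ∂_c φ ∂_d φ`. -/
def gradSq (G : E4 → Matrix (Fin 4) (Fin 4) ℝ) (φ : E4 → ℝ) (x : E4) : ℝ :=
  ∑ c, ∑ d, (G x)⁻¹ c d * pd φ c x * pd φ d x

variable {U : Set E4} {G : E4 → Matrix (Fin 4) (Fin 4) ℝ} {N : E4 → Fin 4 → ℝ} {φ : E4 → ℝ}
  {x : E4}

/-- The conformal metric `e^φ g`. -/
def scale (φ : E4 → ℝ) (G : E4 → Matrix (Fin 4) (Fin 4) ℝ) (x : E4) : Matrix (Fin 4) (Fin 4) ℝ :=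
  Real.exp (φ x) • G x

lemma gradSq_eq (G : E4 → Matrix (Fin 4) (Fin 4) ℝ) (φ : E4 → ℝ) (x : E4) :
    gradSq G φ x = ∑ c, pd φ c x * grad G φ x c := by
  unfold gradSq grad
  simp only [Finset.mul_sum]
  exact Finset.sum_congr rfl fun c _ => Finset.sum_congr rfl fun d _ => by ring

lemma scale_inv (φ : E4 → ℝ) (G : E4 → Matrix (Fin 4) (Fin 4) ℝ) (hd : (G x).det ≠ 0)
    (a b : Fin 4) : (scale φ G x)⁻¹ a b = Real.exp (-φ x) * (G x)⁻¹ a b := by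
  have : (scale φ G x)⁻¹ = Real.exp (-φ x) • (G x)⁻¹ := by
    apply Matrix.inv_eq_left_inv
    rw [scale, Matrix.smul_mul, Matrix.mul_smul, smul_smul, ← Real.exp_add,
      Matrix.nonsing_inv_mul _ hd.isUnit]
    simp
  rw [this]; rfl

lemma trace_add (S S' : Matrix (Fin 4) (Fin 4) ℝ) :
    trace G (S + S') x = trace G S x + trace G S' x := by
  simp [trace, mul_add, Finset.sum_add_distrib]

lemma trace_smul (r : ℝ) (S : Matrix (Fin 4) (Fin 4) ℝ) :
    trace G (r • S) x = r * trace G S x := by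
  simp only [trace, Finset.mul_sum, Matrix.smul_apply, smul_eq_mul]
  exact Finset.sum_congr rfl fun a _ => Finset.sum_congr rfl fun b _ => by ring

lemma trace_sub (S S' : Matrix (Fin 4) (Fin 4) ℝ) :
    trace G (S - S') x = trace G S x - trace G S' x := by
  simp [trace, mul_sub, Finset.sum_sub_distrib]

lemma trace_scale (hd : (G x).det ≠ 0) (S : Matrix (Fin 4) (Fin 4) ℝ) :
    trace (scale φ G) S x = Real.exp (-φ x) * trace G S x := by
  simp only [trace, scale_inv φ G hd, Finset.mul_sum]
  exact Finset.sum_congr rfl fun a _ => Finset.sum_congr rfl fun b _ => by ring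

/-- The matrix `∂_a φ ∂_b φ`. -/
def dSq (φ : E4 → ℝ) (x : E4) : Matrix (Fin 4) (Fin 4) ℝ :=
  Matrix.of fun a b => pd φ a x * pd φ b x

lemma trace_dSq (G : E4 → Matrix (Fin 4) (Fin 4) ℝ) (φ : E4 → ℝ) (x : E4) :
    trace G (dSq φ x) x = gradSq G φ x := by
  simp only [trace, dSq, gradSq, Matrix.of_apply]
  exact Finset.sum_congr rfl fun a _ => Finset.sum_congr rfl fun b _ => by ring

namespace MetricOn

lemma trace_self (h : MetricOn U G) (hx : x ∈ U) : trace G (G x) x = 4 := by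
  have (a : Fin 4) : ∑ b, (G x)⁻¹ a b * G x a b = 1 := by
    have := h.sum_inv_mul hx a a
    simp only [if_true] at this
    rw [← this]
    exact Finset.sum_congr rfl fun b _ => by rw [h.symm x hx]
  simp [trace, this]

lemma smooth_grad (h : MetricOn U G) (hφ : ContDiffOn ℝ ∞ φ U) (c : Fin 4) :
    ContDiffOn ℝ ∞ (fun y => grad G φ y c) U :=
  ContDiffOn.sum fun d _ => (h.smooth_inv c d).mul (contDiffOn_pd h.isOpen hφ d)

lemma sum_mul_grad (h : MetricOn U G) (hx : x ∈ U) (a : Fin 4) :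
    ∑ c, G x a c * grad G φ x c = pd φ a x := by
  have : (G x).mulVec ((G x)⁻¹.mulVec fun d => pd φ d x) = fun d => pd φ d x := by
    rw [Matrix.mulVec_mulVec, h.mul_inv hx, Matrix.one_mulVec]
  exact congrFun this a

lemma lower_grad (h : MetricOn U G) (hx : x ∈ U) (a : Fin 4) :
    lower G (grad G φ) x a = pd φ a x := by
  rw [← h.sum_mul_grad hx a]
  exact Finset.sum_congr rfl fun c _ => by rw [h.symm x hx]

lemma box_eq_divergence (h : MetricOn U G) (hφ : ContDiffOn ℝ ∞ φ U) (hx : x ∈ U) :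
    box G φ x = divergence G (grad G φ) x := by
  have e (a b : Fin 4) : hessian G φ x a b = nablaCovector G (lower G (grad G φ)) a b x := by
    simp only [hessian, Matrix.of_apply, nablaCovector]
    rw [← pd_congr_on h.isOpen (fun y hy => h.lower_grad hy b) hx]
    simp only [h.lower_grad hx]
  simp only [box, trace, e, h.nablaCovector_lower (h.smooth_grad hφ) hx, divergence]
  refine Finset.sum_congr rfl fun a _ => ?_
  simp only [Finset.mul_sum]
  rw [Finset.sum_comm]
  simp only [← mul_assoc, ← Finset.sum_mul, h.sum_inv_mul hx, ite_mul, one_mul, zero_mul]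
  simp

lemma scale (h : MetricOn U G) (hφ : ContDiffOn ℝ ∞ φ U) : MetricOn U (scale φ G) where
  isOpen := h.isOpen
  smooth a b := (hφ.exp).mul (h.smooth a b)
  symm y hy a b := by simp [ConfRay.scale, h.symm y hy a b]
  det_ne y hy := by
    simp only [ConfRay.scale, Matrix.det_smul]
    exact mul_ne_zero (pow_ne_zero _ (Real.exp_ne_zero _)) (h.det_ne y hy)

/-- The corrected symbols are symmetric and preserve e^φ g, so uniqueness of the Levi-Civita
connection gives the claim without inverting the rescaled metric. -/
lemma christoffel_scale (h : MetricOn U G) (hφ : ContDiffOn ℝ ∞ φ U) (hx : x ∈ U)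
    (c a b : Fin 4) : christoffel (ConfRay.scale φ G) c a b x = christoffel G c a b x
      + confDiff (G x) (fun d => pd φ d x) (grad G φ x) c a b := by
  have hφ' := differentiableAt_of_smooth h.isOpen hφ hx
  refine (h.scale hφ).eq_christoffel hx (C := fun c a b => christoffel G c a b x
      + confDiff (G x) (fun d => pd φ d x) (grad G φ x) c a b) ?_ ?_ c a b
  · intro c a b
    rw [h.christoffel_symm hx, confDiff_symm (h.symm x hx)]
  · intro c a b
    have e1 : pd (fun y => ConfRay.scale φ G y a b) c x
        = Real.exp (φ x) * (pd φ c x * G x a b + pd (fun y => G y a b) c x) := by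
      rw [show (fun y => ConfRay.scale φ G y a b) = fun y => Real.exp (φ y) * G y a b from rfl,
        pd_mul hφ'.exp (h.diff hx a b), pd_real_comp (Real.hasDerivAt_exp _) hφ']
      ring
    have e2 (a b : Fin 4) : ∑ d, ConfRay.scale φ G x b d * (christoffel G d c a x
        + confDiff (G x) (fun d => pd φ d x) (grad G φ x) d c a)
        = Real.exp (φ x) * (∑ d, G x b d * christoffel G d c a x + (1 / 2) *
          (G x b c * pd φ a x + G x b a * pd φ c x - G x c a * pd φ b x)) := by
      have := sum_mul_confDiff (g := G x) (p := fun d => pd φ d x) (q := grad G φ x)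
        (fun d => G x b d) c a
      rw [h.sum_mul_grad hx b] at this
      rw [← this, ← Finset.sum_add_distrib, Finset.mul_sum]
      exact Finset.sum_congr rfl fun d _ => by
        simp only [ConfRay.scale, Matrix.smul_apply, smul_eq_mul]; ring
    rw [e1, e2, e2, h.pd_metric hx, h.symm x hx b a, h.symm x hx b c, h.symm x hx a c]
    ring

/-- The conformal transformation of the Ricci tensor. -/
lemma ricci_scale (h : MetricOn U G) (hφ : ContDiffOn ℝ ∞ φ U) (hx : x ∈ U) :
    ricci (ConfRay.scale φ G) x = ricci G x - hessian G φ x + (1 / 2 : ℝ) • dSq φ x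
      - ((1 / 2) * (box G φ x + gradSq G φ x)) • G x := by
  have hU := h.isOpen
  have hp (a : Fin 4) : DifferentiableAt ℝ (pd φ a) x :=
    differentiableAt_of_smooth hU (contDiffOn_pd hU hφ a) hx
  have hq (a : Fin 4) : DifferentiableAt ℝ (fun y => grad G φ y a) x :=
    differentiableAt_of_smooth hU (h.smooth_grad hφ a) hx
  have hpd (e c a b : Fin 4) : pd (christoffel (ConfRay.scale φ G) c a b) e x
      = pd (christoffel G c a b) e x + (1 / 2) * ((if c = a then pd (pd φ b) e x else 0)
      + (if c = b then pd (pd φ a) e x else 0) - (pd (fun y => G y a b) e x * grad G φ x c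
        + G x a b * pd (fun y => grad G φ y c) e x)) := by
    rw [pd_congr_on hU (fun y hy => h.christoffel_scale hφ hy c a b) hx]
    have h1 : DifferentiableAt ℝ (fun y => if c = a then pd φ b y else 0) x := by
      split_ifs
      · exact hp b
      · fun_prop
    have h2 : DifferentiableAt ℝ (fun y => if c = b then pd φ a y else 0) x := by
      split_ifs
      · exact hp a
      · fun_prop
    have h3 : DifferentiableAt ℝ (fun y => G y a b * grad G φ y c) x := (h.diff hx a b).mul (hq c)
    have i1 : pd (fun y => if c = a then pd φ b y else 0) e x
        = if c = a then pd (pd φ b) e x else 0 := by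
      split_ifs <;> simp
    have i2 : pd (fun y => if c = b then pd φ a y else 0) e x
        = if c = b then pd (pd φ a) e x else 0 := by
      split_ifs <;> simp
    have h4 := (h1.fun_add h2).fun_sub h3
    rw [pd_add (v := fun y => confDiff (G y) (fun d => pd φ d y) (grad G φ y) c a b)
      (differentiableAt_of_smooth hU (h.smooth_christoffel c a b) hx) (h4.const_mul _)]
    congr 1
    refine (pd_const_mul h4 (1 / 2) e).trans ?_
    rw [pd_sub (h1.fun_add h2) h3, pd_add h1 h2,
      pd_mul (u := fun y => G y a b) (v := fun y => grad G φ y c) (h.diff hx a b) (hq c), i1, i2]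
  ext a b
  -- The underscore for `dC` is found by unification: the last hypothesis is discharged by `rfl`,
  -- which makes `dC` the derivative of `confDiff` appearing in `hpd`.
  have key := conformal_ricci_algebra (g := G x) (p := fun d => pd φ d x) (q := grad G φ x)
    (fun c a b => christoffel G c a b x) (fun e c a b => pd (christoffel G c a b) e x)
    (fun a b => pd (pd φ b) a x) (fun a c => pd (fun y => grad G φ y c) a x)
    (fun c a b => pd (fun y => G y a b) c x) _ (h.symm x hx)
    (fun c a b => h.christoffel_symm hx c a b) (fun a b => pd_comm hU hφ hx b a)
    (h.sum_mul_grad hx)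
    (fun b a => by
      rw [← pd_congr_on hU (fun y hy => h.sum_mul_grad (φ := φ) hy a) hx,
        pd_sum _ (u := fun c y => G y a c * grad G φ y c)
          fun c _ => (h.diff hx a c).mul (hq c)]
      exact Finset.sum_congr rfl fun c _ => (pd_mul (h.diff hx a c) (hq c) b).symm)
    (fun c a b => h.pd_metric hx c a b) (fun _ _ _ _ => rfl) a b
  simp only [Matrix.sub_apply, Matrix.add_apply, Matrix.smul_apply, smul_eq_mul]
  rw [h.box_eq_divergence hφ hx, gradSq_eq]
  simp only [eq_self, if_true] at key
  simp only [ricci, Matrix.of_apply, hpd, h.christoffel_scale hφ hx, eq_self, if_true]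
  rw [key]
  simp only [hessian, dSq, nablaCovector, divergence, nablaVector, Matrix.of_apply]
  ring

lemma hessian_scale (h : MetricOn U G) (hφ : ContDiffOn ℝ ∞ φ U) (hx : x ∈ U) :
    hessian (ConfRay.scale φ G) φ x = hessian G φ x - dSq φ x
      + ((1 / 2) * gradSq G φ x) • G x := by
  ext a b
  simp only [hessian, Matrix.of_apply, nablaCovector, h.christoffel_scale hφ hx, add_mul,
    Finset.sum_add_distrib, Matrix.sub_apply, Matrix.add_apply, Matrix.smul_apply, smul_eq_mul, dSq]
  have : ∑ c, confDiff (G x) (fun d => pd φ d x) (grad G φ x) c a b * pd φ c x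
      = pd φ a x * pd φ b x - (1 / 2) * gradSq G φ x * G x a b := by
    rw [gradSq_eq, Finset.sum_congr rfl fun c _ => mul_comm _ (pd φ c x),
      sum_mul_confDiff (fun c => pd φ c x)]
    ring
  rw [this]
  ring

/-- The coefficient of (∂φ)² is -1 + 4/2 = 1. The same combination occurs in `box_exp`, so □̃φ =
e^{-2φ} □e^φ, and this links the wave equation to the trace equation. -/
lemma box_scale (h : MetricOn U G) (hφ : ContDiffOn ℝ ∞ φ U) (hx : x ∈ U) :
    box (ConfRay.scale φ G) φ x = Real.exp (-φ x) * (box G φ x + gradSq G φ x) := by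
  rw [box, trace_scale (h.det_ne x hx), h.hessian_scale hφ hx, trace_add, trace_sub, trace_smul,
    h.trace_self hx, trace_dSq, box]
  ring

lemma hessian_exp (h : MetricOn U G) (hφ : ContDiffOn ℝ ∞ φ U) (hx : x ∈ U) :
    hessian G (fun y => Real.exp (φ y)) x = Real.exp (φ x) • (hessian G φ x + dSq φ x) := by
  have hU := h.isOpen
  have hφ' {y : E4} (hy : y ∈ U) := differentiableAt_of_smooth hU hφ hy
  have e1 {y : E4} (hy : y ∈ U) (a : Fin 4) :
      pd (fun y => Real.exp (φ y)) a y = Real.exp (φ y) * pd φ a y :=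
    pd_real_comp (Real.hasDerivAt_exp _) (hφ' hy) a
  ext a b
  simp only [hessian, Matrix.of_apply, nablaCovector, Matrix.smul_apply, Matrix.add_apply, dSq,
    smul_eq_mul, e1 hx]
  rw [pd_congr_on hU (fun y hy => e1 hy b) hx, pd_mul (hφ' hx).exp
    (differentiableAt_of_smooth hU (contDiffOn_pd hU hφ b) hx), e1 hx]
  have : ∑ c, christoffel G c a b x * (Real.exp (φ x) * pd φ c x)
      = Real.exp (φ x) * ∑ c, christoffel G c a b x * pd φ c x := by
    rw [Finset.mul_sum]
    exact Finset.sum_congr rfl fun c _ => by ring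
  rw [this]
  ring

lemma box_exp (h : MetricOn U G) (hφ : ContDiffOn ℝ ∞ φ U) (hx : x ∈ U) :
    box G (fun y => Real.exp (φ y)) x = Real.exp (φ x) * (box G φ x + gradSq G φ x) := by
  rw [box, h.hessian_exp hφ hx, trace_smul, trace_add, trace_dSq, box]

end MetricOn

namespace ClosedUnitOn

/-- The conformal unit field `e^{-φ/2} n`. -/
def scaleVec (φ : E4 → ℝ) (N : E4 → Fin 4 → ℝ) (x : E4) (a : Fin 4) : ℝ :=
  Real.exp (-φ x / 2) * N x a

lemma lower_scale (y : E4) (b : Fin 4) :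
    lower (ConfRay.scale φ G) (scaleVec φ N) y b = Real.exp (φ y / 2) * lower G N y b := by
  have : Real.exp (φ y) * Real.exp (-φ y / 2) = Real.exp (φ y / 2) := by
    rw [← Real.exp_add]; congr 1; ring
  simp only [lower, ConfRay.scale, scaleVec, Matrix.smul_apply, smul_eq_mul, Finset.mul_sum,
    ← this]
  exact Finset.sum_congr rfl fun a _ => by ring

lemma along_scale (u : E4 → ℝ) (y : E4) :
    along (scaleVec φ N) u y = Real.exp (-φ y / 2) * along N u y := by
  simp only [along, scaleVec, Finset.mul_sum]
  exact Finset.sum_congr rfl fun a _ => by ring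

/-- The differential of e^{φ/2} n♭ is e^{φ/2} (½ dφ ∧ n♭ + dn♭). The first term vanishes because dφ
is parallel to n♭, the second because n♭ is closed. -/
lemma scale (h : ClosedUnitOn U G N) (hφ : ContDiffOn ℝ ∞ φ U)
    (hN : ∀ y ∈ U, ∀ a, pd φ a y = -(along N φ y) * lower G N y a) :
    ClosedUnitOn U (ConfRay.scale φ G) (scaleVec φ N) where
  metric := h.metric.scale hφ
  smooth a := ((hφ.neg.div_const 2).exp).mul (h.smooth a)
  unit y hy := by
    simp only [lower_scale, scaleVec]
    rw [← h.unit y hy]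
    refine Finset.sum_congr rfl fun a _ => ?_
    have : Real.exp (φ y / 2) * Real.exp (-φ y / 2) = 1 := by
      rw [← Real.exp_add, show φ y / 2 + -φ y / 2 = 0 by ring, Real.exp_zero]
    linear_combination (lower G N y a * N y a) * this
  closed y hy a b := by
    have hφ' := differentiableAt_of_smooth h.metric.isOpen hφ hy
    have e (a b : Fin 4) : pd (fun z => lower (ConfRay.scale φ G) (scaleVec φ N) z b) a y
        = Real.exp (φ y / 2) * ((1 / 2) * pd φ a y * lower G N y b
          + pd (fun z => lower G N z b) a y) := by
      simp only [lower_scale]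
      rw [pd_mul (u := fun z => Real.exp (φ z / 2)) (by fun_prop) (h.diff_lower hy b),
        pd_real_comp (h := fun r => Real.exp (r / 2))
          ((Real.hasDerivAt_exp _).comp _ ((hasDerivAt_id (φ y)).div_const 2)) hφ']
      ring
    rw [e, e, h.closed y hy a b, hN y hy, hN y hy]
    ring

lemma pd_eq_scale (hN : ∀ y ∈ U, ∀ a, pd φ a y = -(along N φ y) * lower G N y a) (y : E4)
    (hy : y ∈ U) (a : Fin 4) : pd φ a y = -(along (scaleVec φ N) φ y)
      * lower (ConfRay.scale φ G) (scaleVec φ N) y a := by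
  rw [along_scale, lower_scale, hN y hy]
  have : Real.exp (φ y / 2) * Real.exp (-φ y / 2) = 1 := by
    rw [← Real.exp_add, show φ y / 2 + -φ y / 2 = 0 by ring, Real.exp_zero]
  linear_combination (along N φ y * lower G N y a) * this

end ClosedUnitOn

end

/-! ### The potential -/

section Potential

variable {f : ℝ → ℝ} {D : Set ℝ} {r : ℝ}

lemma hasStrictDerivAt_deriv (hD : IsOpen D) (hf : ContDiffOn ℝ ∞ f D) (hr : r ∈ D) :
    HasStrictDerivAt (deriv f) (deriv (deriv f) r) r := by
  have : ContDiffOn ℝ ∞ (deriv f) D := hf.deriv_of_isOpen hD (by simp)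
  exact (this.contDiffAt (hD.mem_nhds hr)).hasStrictDerivAt (by simp)

lemma hasDerivAt_of_smooth (hD : IsOpen D) (hf : ContDiffOn ℝ ∞ f D) (hr : r ∈ D) :
    HasDerivAt f (deriv f r) r :=
  ((hf.contDiffAt (hD.mem_nhds hr)).differentiableAt (by simp)).hasDerivAt

/-- Injectivity on D makes `invFunOn` a left inverse of f' near r, and f'' ≠ 0 lets the inverse
function theorem differentiate it. -/
lemma hasDerivAt_invFunOn_deriv (hD : IsOpen D) (hf : ContDiffOn ℝ ∞ f D)
    (hinj : Set.InjOn (deriv f) D) (h2 : deriv (deriv f) r ≠ 0) (hr : r ∈ D) :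
    HasDerivAt (Function.invFunOn (deriv f) D) (deriv (deriv f) r)⁻¹ (deriv f r) := by
  refine ((hasStrictDerivAt_deriv hD hf hr).to_local_left_inverse h2 ?_).hasDerivAt
  filter_upwards [hD.mem_nhds hr] with y hy using hinj.leftInvOn_invFunOn hy

lemma potential_log (hinj : Set.InjOn (deriv f) D) (hpos : 0 < deriv f r) (hr : r ∈ D) :
    potential f D (Real.log (deriv f r))
      = (1 / 2) * (deriv f r ^ 2)⁻¹ * (r * deriv f r - f r) := by
  simp only [potential, Real.exp_log hpos, hinj.leftInvOn_invFunOn hr]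

/-- Chain rule through R, with dφ/dR = f''/f'. Every term of dV/dR contains f'', so f'' cancels in
the quotient. -/
lemma hasDerivAt_potential (hD : IsOpen D) (hf : ContDiffOn ℝ ∞ f D)
    (hinj : Set.InjOn (deriv f) D) (hpos : 0 < deriv f r) (h2 : deriv (deriv f) r ≠ 0)
    (hr : r ∈ D) :
    HasDerivAt (potential f D) (f r / deriv f r ^ 2 - (1 / 2) * (r / deriv f r))
      (Real.log (deriv f r)) := by
  have hv : HasDerivAt (fun s => (1 / 2) * (deriv f s ^ 2)⁻¹ * (s * deriv f s - f s))
      ((1 / 2) * (-(2 * deriv f r * deriv (deriv f) r) / (deriv f r ^ 2) ^ 2)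
        * (r * deriv f r - f r) + (1 / 2) * (deriv f r ^ 2)⁻¹ * (r * deriv (deriv f) r)) r := by
    have h1 := (hasStrictDerivAt_deriv hD hf hr).hasDerivAt
    refine ((((h1.fun_pow 2).fun_inv (pow_ne_zero 2 hpos.ne')).const_mul (1 / 2 : ℝ)).mul
      (((hasDerivAt_id r).mul h1).sub (hasDerivAt_of_smooth hD hf hr))).congr_deriv ?_
    simp
  have hρ : HasDerivAt (fun s => Function.invFunOn (deriv f) D (Real.exp s)) _
      (Real.log (deriv f r)) :=
    HasDerivAt.comp (Real.log (deriv f r))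
      (h₂ := Function.invFunOn (deriv f) D) (h₂' := (deriv (deriv f) r)⁻¹)
      (by rw [Real.exp_log hpos]; exact hasDerivAt_invFunOn_deriv hD hf hinj h2 hr)
      (Real.hasDerivAt_exp _)
  have e : Function.invFunOn (deriv f) D (Real.exp (Real.log (deriv f r))) = r := by
    rw [Real.exp_log hpos, hinj.leftInvOn_invFunOn hr]
  refine (HasDerivAt.comp_of_eq (Real.log (deriv f r)) hv hρ e.symm).congr_deriv ?_
  rw [Real.exp_log hpos]
  field_simp
  ring

end Potential

noncomputable section

/-! ### Field equations in the two frames -/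

variable {G : E4 → Matrix (Fin 4) (Fin 4) ℝ} {N : E4 → Fin 4 → ℝ} {φ : E4 → ℝ} {x : E4}

lemma contract_add (S S' : Matrix (Fin 4) (Fin 4) ℝ) (X : Fin 4 → ℝ) :
    contract (S + S') X = contract S X + contract S' X := by
  simp [contract, add_mul, Finset.sum_add_distrib]

lemma contract_smul (r : ℝ) (S : Matrix (Fin 4) (Fin 4) ℝ) (X : Fin 4 → ℝ) :
    contract (r • S) X = r * contract S X := by
  simp only [contract, Finset.mul_sum, Matrix.smul_apply, smul_eq_mul]
  exact Finset.sum_congr rfl fun a _ => Finset.sum_congr rfl fun b _ => by ring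

lemma contract_vec_smul (r : ℝ) (S : Matrix (Fin 4) (Fin 4) ℝ) (X : Fin 4 → ℝ) :
    contract S (fun a => r * X a) = r ^ 2 * contract S X := by
  simp only [contract, Finset.mul_sum]
  exact Finset.sum_congr rfl fun a _ => Finset.sum_congr rfl fun b _ => by ring

/-- Used with `S` the true Ricci tensor, for which the equation is a theorem: an equation with a
prescribed Ricci tensor then becomes a condition on a single component. -/
lemma raychaudhuri_congr {S S' : Matrix (Fin 4) (Fin 4) ℝ}
    (h : Raychaudhuri G N S x) :
    Raychaudhuri G N S' x ↔ contract S (N x) = contract S' (N x) := by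
  unfold Raychaudhuri at *
  rw [h]
  constructor <;> intro h <;> linarith

/-- A chart of the two frames: `g` with its closed unit field `n`, the function `φ`, and the data
of an `f(R)` theory with `e^φ = f'(R)`. -/
structure FrameData (U : Set E4) (G : E4 → Matrix (Fin 4) (Fin 4) ℝ) (N : E4 → Fin 4 → ℝ)
    (φ : E4 → ℝ) (f : ℝ → ℝ) (D : Set ℝ) (R : E4 → ℝ) : Prop where
  unit : ClosedUnitOn U G N
  smooth : ContDiffOn ℝ ∞ φ U
  parallel : ∀ y ∈ U, ∀ a, pd φ a y = -(along N φ y) * lower G N y a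
  scalar : ∀ y ∈ U, R y = trace G (ricci G y) y
  isOpen : IsOpen D
  smooth_fun : ContDiffOn ℝ ∞ f D
  injOn : Set.InjOn (deriv f) D
  two : ∀ r ∈ D, deriv (deriv f) r ≠ 0
  mem : ∀ y, R y ∈ D
  exp_eq : ∀ y, deriv f (R y) = Real.exp (φ y)

/-! ### Both systems in terms of the residual of the f(R) equations -/

namespace FrameData

variable {U : Set E4} {f : ℝ → ℝ} {D : Set ℝ} {R : E4 → ℝ} {S : E4 → Matrix (Fin 4) (Fin 4) ℝ}

/-- The difference of the two sides of the `f(R)` equations. -/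
def residual (G : E4 → Matrix (Fin 4) (Fin 4) ℝ) (φ : E4 → ℝ) (f : ℝ → ℝ) (R : E4 → ℝ)
    (S : E4 → Matrix (Fin 4) (Fin 4) ℝ) (x : E4) : Matrix (Fin 4) (Fin 4) ℝ :=
  Real.exp (φ x) • (ricci G x - (hessian G φ x + dSq φ x) + (box G φ x + gradSq G φ x) • G x)
    - ((1 / 2) * f (R x)) • G x - S x

/-- The total stress tensor in the conformal frame. -/
def stress (G : E4 → Matrix (Fin 4) (Fin 4) ℝ) (φ : E4 → ℝ) (f : ℝ → ℝ) (D : Set ℝ)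
    (S : E4 → Matrix (Fin 4) (Fin 4) ℝ) (x : E4) : Matrix (Fin 4) (Fin 4) ℝ :=
  scalarStress (scale φ G) φ (potential f D) x + Real.exp (-φ x) • S x

lemma exp_mul_exp_neg (r : ℝ) : Real.exp r * Real.exp (-r) = 1 := by
  rw [← Real.exp_add, add_neg_cancel, Real.exp_zero]

lemma log_eq (h : FrameData U G N φ f D R) (y : E4) : Real.log (deriv f (R y)) = φ y := by
  rw [h.exp_eq, Real.log_exp]

lemma fr_fun_eq (h : FrameData U G N φ f D R) :
    (fun y => deriv f (R y)) = fun y => Real.exp (φ y) := funext h.exp_eq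

lemma deriv_pos (h : FrameData U G N φ f D R) (y : E4) : 0 < deriv f (R y) := by
  rw [h.exp_eq]; exact Real.exp_pos _

lemma frEquations_iff (h : FrameData U G N φ f D R) (hx : x ∈ U) :
    FREquations f G R S x ↔ residual G φ f R S x = 0 := by
  rw [FREquations, h.fr_fun_eq, h.exp_eq, h.unit.metric.hessian_exp h.smooth hx,
    h.unit.metric.box_exp h.smooth hx, ← sub_eq_zero]
  refine Eq.congr ?_ rfl
  rw [residual]
  module

lemma ricci_sub_frRicci (h : FrameData U G N φ f D R) (hx : x ∈ U) :
    ricci G x = frRicci f G R S x + Real.exp (-φ x) • residual G φ f R S x := by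
  rw [frRicci, h.fr_fun_eq, h.exp_eq, h.unit.metric.hessian_exp h.smooth hx,
    h.unit.metric.box_exp h.smooth hx, ← Real.exp_neg, residual]
  have := exp_mul_exp_neg (φ x)
  ext a b
  simp only [Matrix.add_apply, Matrix.sub_apply, Matrix.smul_apply, smul_eq_mul]
  linear_combination (-ricci G x a b) * this

lemma trace_residual (h : FrameData U G N φ f D R) (hx : x ∈ U) :
    trace G (residual G φ f R S x) x = Real.exp (φ x) * R x - 2 * f (R x)
      + 3 * (Real.exp (φ x) * (box G φ x + gradSq G φ x)) - trace G (S x) x := by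
  simp only [residual, trace_add, trace_sub, trace_smul, h.unit.metric.trace_self hx, trace_dSq,
    ← h.scalar x hx]
  rw [show trace G (hessian G φ x) x = box G φ x from rfl]
  ring

lemma frTraceEquation_iff (h : FrameData U G N φ f D R) (hx : x ∈ U) :
    FRTraceEquation f G R S x ↔ trace G (residual G φ f R S x) x = 0 := by
  rw [FRTraceEquation, h.fr_fun_eq, h.exp_eq, h.unit.metric.box_exp h.smooth hx,
    h.trace_residual hx, ← sub_eq_zero]

/-- The conformal stress in terms of g. The potential was chosen so that e^φ V = ½ (R - e^{-φ} f).
-/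
lemma stress_eq (h : FrameData U G N φ f D R) (hx : x ∈ U) :
    stress G φ f D S x = (3 / 2 : ℝ) • dSq φ x - ((3 / 4) * gradSq G φ x) • G x
      - ((1 / 2) * (R x - Real.exp (-φ x) * f (R x))) • G x + Real.exp (-φ x) • S x := by
  have he := exp_mul_exp_neg (φ x)
  have hV : potential f D (φ x)
      = (1 / 2) * Real.exp (-φ x) ^ 2 * (R x * Real.exp (φ x) - f (R x)) := by
    have := potential_log h.injOn (h.deriv_pos x) (h.mem x)
    rw [h.log_eq, h.exp_eq] at this
    rw [this, ← inv_pow, Real.exp_neg]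
  have hg : ∑ c, ∑ d, (scale φ G x)⁻¹ c d * pd φ c x * pd φ d x
      = Real.exp (-φ x) * gradSq G φ x := by
    simp only [scale_inv φ G (h.unit.metric.det_ne x hx), gradSq, Finset.mul_sum, mul_assoc]
  unfold stress
  congr 1
  ext a b
  simp only [scalarStress, Matrix.of_apply, Matrix.sub_apply, Matrix.smul_apply, smul_eq_mul, hV,
    hg, dSq]
  simp only [scale, Matrix.smul_apply, smul_eq_mul]
  -- The coefficient records where e^φ e^{-φ} becomes 1. In the potential term this product occurs
  -- squared, whence the factor with + 1.
  linear_combination (-(3 / 4) * gradSq G φ x * G x a b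
    - (1 / 2) * G x a b * (R x * (Real.exp (φ x) * Real.exp (-φ x) + 1)
      - Real.exp (-φ x) * f (R x))) * he

/-- The identity on which the equivalence rests. The conformal Ricci tensor contains -∇∇φ + ½ dφ dφ,
whereas dividing ∇∇f' by f' gives ∇∇φ + dφ dφ; the difference 3/2 dφ dφ is the kinetic part of the
scalar stress. -/
lemma einstein_eq (h : FrameData U G N φ f D R) (hx : x ∈ U) :
    einstein (scale φ G) x
      = stress G φ f D S x + Real.exp (-φ x) • residual G φ f R S x := by
  have he := exp_mul_exp_neg (φ x)
  rw [einstein, trace_scale (h.unit.metric.det_ne x hx), h.unit.metric.ricci_scale h.smooth hx,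
    h.stress_eq hx, residual]
  simp only [trace_add, trace_sub, trace_smul, h.unit.metric.trace_self hx, trace_dSq,
    ← h.scalar x hx]
  rw [show trace G (hessian G φ x) x = box G φ x from rfl]
  ext a b
  simp only [Matrix.add_apply, Matrix.sub_apply, Matrix.smul_apply, smul_eq_mul, scale]
  linear_combination (-(1 / 2) * (R x - 3 * box G φ x - (3 / 2) * gradSq G φ x) * G x a b
    - (ricci G x a b - (hessian G φ x a b + dSq φ x a b)
      + (box G φ x + gradSq G φ x) * G x a b)) * he

/-- In dimension four trace reversal is an involution. -/
lemma einsteinRicci_einstein (h : FrameData U G N φ f D R) (hx : x ∈ U) :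
    einsteinRicci (scale φ G) (einstein (scale φ G) x) x = ricci (scale φ G) x := by
  rw [einsteinRicci, einstein, trace_sub, trace_smul,
    (h.unit.metric.scale h.smooth).trace_self hx]
  module

lemma ricci_scale_eq (h : FrameData U G N φ f D R) (hx : x ∈ U) :
    ricci (scale φ G) x = einsteinRicci (scale φ G) (stress G φ f D S x) x
      + Real.exp (-φ x) • (residual G φ f R S x
        - ((1 / 2) * trace G (residual G φ f R S x) x) • G x) := by
  have he := exp_mul_exp_neg (φ x)
  rw [← h.einsteinRicci_einstein hx, h.einstein_eq (S := S) hx, einsteinRicci, einsteinRicci,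
    trace_add, trace_smul, trace_scale (h.unit.metric.det_ne x hx) (residual G φ f R S x)]
  ext a b
  simp only [Matrix.add_apply, Matrix.sub_apply, Matrix.smul_apply, smul_eq_mul, scale]
  linear_combination (-(1 / 2) * Real.exp (-φ x) * trace G (residual G φ f R S x) x * G x a b) * he

lemma einstein_iff (h : FrameData U G N φ f D R) (hx : x ∈ U) :
    FREquations f G R S x ↔ einstein (scale φ G) x = stress G φ f D S x := by
  rw [h.frEquations_iff hx, h.einstein_eq (S := S) hx, add_eq_left, smul_eq_zero_iff_right
    (Real.exp_ne_zero _)]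

lemma hasDerivAt_potential (h : FrameData U G N φ f D R) (x : E4) :
    HasDerivAt (potential f D) (f (R x) / deriv f (R x) ^ 2 - (1 / 2) * (R x / deriv f (R x)))
      (φ x) := by
  have := ConfRay.hasDerivAt_potential h.isOpen h.smooth_fun h.injOn (h.deriv_pos x)
    (h.two _ (h.mem x)) (h.mem x)
  rwa [h.log_eq] at this

/-- With `τ = tr T` this is the equation with source, with `τ = 0` the free one. By `box_eq` in the
conformal frame, `box_scale` and the formula for dV/dφ, the wave equation is -⅓ e^{-2φ} times the
equation on the right. -/
lemma scalarWave_iff (h : FrameData U G N φ f D R) (hx : x ∈ U) (τ : ℝ) :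
    ScalarWave (scale φ G) (ClosedUnitOn.scaleVec φ N) φ (potential f D)
        (-(1 / 3) * (Real.exp (-φ x) ^ 2 * τ)) x
      ↔ trace G (residual G φ f R S x) x + trace G (S x) x = τ := by
  have he := exp_mul_exp_neg (φ x)
  have hb := (h.unit.scale h.smooth h.parallel).box_eq h.smooth
    (ClosedUnitOn.pd_eq_scale h.parallel) hx
  rw [h.unit.metric.box_scale h.smooth hx] at hb
  have hd := ((h.hasDerivAt_potential x).const_mul (2 / 3)).deriv
  rw [h.exp_eq, div_eq_mul_inv (f _), div_eq_mul_inv (R _), ← inv_pow, ← Real.exp_neg] at hd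
  unfold ScalarWave
  rw [hd, h.trace_residual hx]
  have hp := Real.exp_pos (-φ x)
  set F := Real.exp (φ x)
  set E := Real.exp (-φ x)
  constructor
  · intro hw
    have key : E ^ 2 * (F * R x - 2 * f (R x) + 3 * (F * (box G φ x + gradSq G φ x)) - τ) = 0 := by
      linear_combination (-3) * hw + 3 * hb + (E * R x + 3 * E * (box G φ x + gradSq G φ x)) * he
    have := (mul_eq_zero.1 key).resolve_left (by positivity)
    linarith
  · intro hw
    linear_combination (-(1 / 3) * E ^ 2) * hw + hb
      + ((1 / 3) * E * R x + E * (box G φ x + gradSq G φ x)) * he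

lemma raychaudhuri_iff (h : FrameData U G N φ f D R) (hx : x ∈ U) :
    Raychaudhuri G N (frRicci f G R S x) x ↔ contract (residual G φ f R S x) (N x) = 0 := by
  rw [raychaudhuri_congr (h.unit.raychaudhuri hx), h.ricci_sub_frRicci (S := S) hx, contract_add,
    contract_smul, add_eq_left, mul_eq_zero, or_iff_right (Real.exp_ne_zero _)]

/-- The conformal factors of the tensor and of ñ are nonzero and drop out, leaving a condition in
terms of g and n. -/
lemma raychaudhuri_scale_iff (h : FrameData U G N φ f D R) (hx : x ∈ U) :
    Raychaudhuri (scale φ G) (ClosedUnitOn.scaleVec φ N)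
        (einsteinRicci (scale φ G) (stress G φ f D S x) x) x
      ↔ contract (residual G φ f R S x - ((1 / 2) * trace G (residual G φ f R S x) x) • G x) (N x)
        = 0 := by
  rw [raychaudhuri_congr ((h.unit.scale h.smooth h.parallel).raychaudhuri hx),
    h.ricci_scale_eq (S := S) hx, contract_add, contract_smul, add_eq_left, mul_eq_zero,
    or_iff_right (Real.exp_ne_zero _)]
  rw [show ClosedUnitOn.scaleVec φ N x = fun a => Real.exp (-φ x / 2) * N x a from rfl,
    contract_vec_smul, mul_eq_zero, or_iff_right (pow_ne_zero _ (Real.exp_ne_zero _))]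

end FrameData

end

/-! ### Fields on the manifold in charts -/

/-- A function that is constant on the level sets of `τ` has a differential proportional
to `dτ`. -/
lemma fderiv_eq_of_const_on_level {τ ρ : E4 → ℝ} {τ' ρ' : E4 →L[ℝ] ℝ} {x v : E4}
    (hτ : HasStrictFDerivAt τ τ' x) (hρ : HasStrictFDerivAt ρ ρ' x) (hv : τ' v = 1)
    (hc : ∀ᶠ y in 𝓝 x, τ y = τ x → ρ y = ρ x) (w : E4) : ρ' w = ρ' v * τ' w := by
  -- A function constant on the level set has a constrained extremum there, so Lagrange multipliers
  -- apply: the pair (τ', ρ') is not onto.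
  have hext : IsLocalExtrOn ρ {y | τ y = τ x} x := by
    refine Or.inl ?_
    rw [IsMinFilter, eventually_nhdsWithin_iff]
    filter_upwards [hc] with y hy hyx using (hy hyx).ge
  have hne := hext.range_ne_top_of_hasStrictFDerivAt hτ hρ
  have hker (u : E4) (hu : τ' u = 0) : ρ' u = 0 := by
    by_contra h0
    -- If u in ker τ' had ρ' u ≠ 0, then u and v would span the range: the preimage solves a
    -- triangular system, the coefficient of v being fixed first by τ' v = 1.
    refine hne (LinearMap.range_eq_top.2 fun ab => ⟨ab.1 • v + ((ab.2 - ab.1 * ρ' v) / ρ' u) • u, ?_⟩)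
    ext
    · simp [hv, hu]
    · simp [div_mul_cancel₀ _ h0]
  have := hker (w - τ' w • v) (by simp [hv])
  rw [map_sub, map_smul, smul_eq_mul, sub_eq_zero] at this
  rw [this, mul_comm]

lemma MetricOn.mono {U U' : Set E4} {G : E4 → Matrix (Fin 4) (Fin 4) ℝ} (h : MetricOn U G)
    (hU : IsOpen U') (hs : U' ⊆ U) : MetricOn U' G where
  isOpen := hU
  smooth a b := (h.smooth a b).mono hs
  symm x hx := h.symm x (hs hx)
  det_ne x hx := h.det_ne x (hs hx)

section Manifold

variable {M : Type*} [TopologicalSpace M] [ChartedSpace E4 M]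
  {e : OpenPartialHomeomorph M E4} {x : E4}

lemma mdifferentiable_chart (he : e ∈ IsManifold.maximalAtlas (𝓡 4) ∞ M) :
    e.MDifferentiable (𝓡 4) (𝓡 4) :=
  ⟨(contMDiffOn_of_mem_maximalAtlas he).mdifferentiableOn (by simp),
    (contMDiffOn_symm_of_mem_maximalAtlas he).mdifferentiableOn (by simp)⟩

lemma symm_mfderiv_chart (he : e ∈ IsManifold.maximalAtlas (𝓡 4) ∞ M) (hx : x ∈ e.target)
    (v : TangentSpace (𝓡 4) (e.symm x)) :
    mfderiv (𝓡 4) (𝓡 4) e.symm x (mfderiv (𝓡 4) (𝓡 4) e (e.symm x) v) = v := by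
  have := (mdifferentiable_chart he).symm_comp_deriv (e.map_target hx)
  rw [e.right_inv hx] at this
  exact DFunLike.congr_fun this v

lemma mfderiv_symm_chart (he : e ∈ IsManifold.maximalAtlas (𝓡 4) ∞ M) (hx : x ∈ e.target)
    (v : E4) :
    mfderiv (𝓡 4) (𝓡 4) e (e.symm x) (mfderiv (𝓡 4) (𝓡 4) e.symm x v) = v :=
  DFunLike.congr_fun ((mdifferentiable_chart he).comp_symm_deriv hx) v

lemma sum_smul_single (v : E4) : ∑ a, v a • (EuclideanSpace.single a (1 : ℝ) : E4) = v := by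
  simpa using (EuclideanSpace.basisFun (Fin 4) ℝ).sum_repr v

lemma bilin_apply {V : Type*} [AddCommGroup V] [Module ℝ V] [TopologicalSpace V]
    (B : V →L[ℝ] V →L[ℝ] ℝ) (L : E4 →L[ℝ] V) (u v : E4) :
    B (L u) (L v) = ∑ a, ∑ b, u a * v b *
      B (L (EuclideanSpace.single a (1 : ℝ))) (L (EuclideanSpace.single b (1 : ℝ))) := by
  conv_lhs => rw [← sum_smul_single u, ← sum_smul_single v]
  rw [map_sum L, map_sum B, sum_apply]
  refine Finset.sum_congr rfl fun a _ => ?_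
  rw [map_smul, map_smul, smul_apply, map_sum, map_sum, Finset.smul_sum]
  refine Finset.sum_congr rfl fun b _ => ?_
  rw [map_smul, map_smul, smul_eq_mul, smul_eq_mul, mul_assoc]

/-- A tensor field is determined by its components. -/
lemma tensor_apply (B : ∀ p : M, TangentSpace (𝓡 4) p →L[ℝ] TangentSpace (𝓡 4) p →L[ℝ] ℝ)
    (e : OpenPartialHomeomorph M E4) (x : E4) (u v : E4) :
    B (e.symm x) (mfderiv (𝓡 4) (𝓡 4) e.symm x u) (mfderiv (𝓡 4) (𝓡 4) e.symm x v)
      = ∑ a, ∑ b, u a * v b * tensorIn B e x a b := by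
  exact bilin_apply (B (e.symm x)) (mfderiv (𝓡 4) (𝓡 4) e.symm x) u v

variable {g : ∀ p : M, TangentSpace (𝓡 4) p →L[ℝ] TangentSpace (𝓡 4) p →L[ℝ] ℝ}

/-- Nondegeneracy: pairing with an orthonormal basis vector reads off a coordinate up to sign. -/
lemma IsLorentzMetric.eq_zero (h : IsLorentzMetric g) {p : M} {w : TangentSpace (𝓡 4) p}
    (hw : ∀ v, g p v w = 0) : w = 0 := by
  obtain ⟨b, hb⟩ := h.signature p
  have hr : b.repr w = 0 := by
    ext i
    have h1 := hw (b i)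
    rw [← b.sum_repr w, map_sum] at h1
    simp only [map_smul, hb, smul_eq_mul, mul_ite, mul_zero, Finset.sum_ite_eq, Finset.mem_univ,
      if_true] at h1
    split_ifs at h1 <;> simpa using h1
  simpa using hr

lemma IsLorentzMetric.metricOn (h : IsLorentzMetric g)
    (he : e ∈ IsManifold.maximalAtlas (𝓡 4) ∞ M) : MetricOn e.target (tensorIn g e) where
  isOpen := e.open_target
  smooth := h.smooth e he
  symm x _ a b := h.symm _ _ _
  det_ne x hx h0 := by
    -- A kernel vector of the component matrix would represent a nonzero tangent vector orthogonal
    -- to all others.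
    obtain ⟨c, hc0, hc⟩ := Matrix.exists_mulVec_eq_zero_iff.2 h0
    set w : E4 := WithLp.toLp 2 c
    have hw : mfderiv (𝓡 4) (𝓡 4) e.symm x w = 0 := by
      refine h.eq_zero fun v => ?_
      rw [← symm_mfderiv_chart he hx v]
      refine (tensor_apply g e x (mfderiv (𝓡 4) (𝓡 4) e (e.symm x) v : E4) w).trans ?_
      refine Finset.sum_eq_zero fun a _ => ?_
      have := congrFun hc a
      simp only [Matrix.mulVec, dotProduct, Pi.zero_apply] at this
      simp only [mul_assoc, ← Finset.mul_sum]
      rw [show ∑ b, w b * tensorIn g e x a b = 0 by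
        rw [← this]; exact Finset.sum_congr rfl fun b _ => mul_comm _ _, mul_zero]
    have h1 := mfderiv_symm_chart he hx w
    rw [hw, map_zero] at h1
    apply hc0
    have : w = 0 := h1.symm
    simpa [w] using this

/-- An isometry in charts. -/
lemma IsLorentzMetric.isometryOn (h : IsLorentzMetric g) {Φ : M → M}
    (hΦ : ContMDiff (𝓡 4) (𝓡 4) ∞ Φ)
    (hg : ∀ r v w, g (Φ r) (mfderiv (𝓡 4) (𝓡 4) Φ r v) (mfderiv (𝓡 4) (𝓡 4) Φ r w) = g r v w)
    {e₁ e₂ : OpenPartialHomeomorph M E4} (he₁ : e₁ ∈ IsManifold.maximalAtlas (𝓡 4) ∞ M)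
    (he₂ : e₂ ∈ IsManifold.maximalAtlas (𝓡 4) ∞ M) :
    IsometryOn (e₁.target ∩ e₁.symm ⁻¹' (Φ ⁻¹' e₂.source)) e₂.target
      (tensorIn g e₁) (tensorIn g e₂) (fun y => e₂ (Φ (e₁.symm y))) := by
  have hopen : IsOpen (e₁.target ∩ e₁.symm ⁻¹' (Φ ⁻¹' e₂.source)) :=
    e₁.isOpen_inter_preimage_symm (e₂.open_source.preimage hΦ.continuous)
  have hsm : ContDiffOn ℝ ∞ (fun y => e₂ (Φ (e₁.symm y)))
      (e₁.target ∩ e₁.symm ⁻¹' (Φ ⁻¹' e₂.source)) := by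
    rw [← contMDiffOn_iff_contDiffOn]
    refine (contMDiffOn_of_mem_maximalAtlas he₂).comp (t := e₂.source) (hΦ.comp_contMDiffOn
      ((contMDiffOn_symm_of_mem_maximalAtlas he₁).mono Set.inter_subset_left)) fun y hy => hy.2
  refine ⟨(h.metricOn he₁).mono hopen Set.inter_subset_left, h.metricOn he₂, hsm,
    fun y hy => e₂.map_source hy.2, fun y hy => ?_⟩
  set ψ : E4 → E4 := fun y => e₂ (Φ (e₁.symm y)) with hψ
  have hψd : DifferentiableAt ℝ ψ y :=
    (hsm.contDiffAt (hopen.mem_nhds hy)).differentiableAt (by simp)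
  have hy2 : ψ y ∈ e₂.target := e₂.map_source hy.2
  have hinv : e₂.symm (ψ y) = Φ (e₁.symm y) := e₂.left_inv hy.2
  have h1 : HasMFDerivAt (𝓡 4) (𝓡 4) (fun z => e₂.symm (ψ z)) y
      ((mfderiv (𝓡 4) (𝓡 4) e₂.symm (ψ y)).comp (fderiv ℝ ψ y)) :=
    HasMFDerivAt.comp y ((mdifferentiable_chart he₂).mdifferentiableAt_symm hy2).hasMFDerivAt
      hψd.hasFDerivAt.hasMFDerivAt
  have h2 : HasMFDerivAt (𝓡 4) (𝓡 4) (fun z => Φ (e₁.symm z)) y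
      ((mfderiv (𝓡 4) (𝓡 4) Φ (e₁.symm y)).comp (mfderiv (𝓡 4) (𝓡 4) e₁.symm y)) :=
    HasMFDerivAt.comp y ((hΦ.mdifferentiable (by simp)) _).hasMFDerivAt
      ((mdifferentiable_chart he₁).mdifferentiableAt_symm hy.1).hasMFDerivAt
  have h3 : (fun z => e₂.symm (ψ z)) =ᶠ[𝓝 y] fun z => Φ (e₁.symm z) := by
    filter_upwards [hopen.mem_nhds hy] with z hz using e₂.left_inv hz.2
  -- Both maps agree near y, so their differentials agree; this expresses dΦ through the Jacobian of
  -- ψ.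
  have h4 := hasMFDerivAt_unique (h2.congr_of_eventuallyEq h3) h1
  have h5 (a : Fin 4) : mfderiv (𝓡 4) (𝓡 4) Φ (e₁.symm y) (mfderiv (𝓡 4) (𝓡 4) e₁.symm y
      (EuclideanSpace.single a (1 : ℝ) : E4)) = mfderiv (𝓡 4) (𝓡 4) e₂.symm (ψ y)
        (fderiv ℝ ψ y (EuclideanSpace.single a (1 : ℝ))) :=
    DFunLike.congr_fun h4 (EuclideanSpace.single a (1 : ℝ) : E4)
  ext a b
  have h6 : tensorIn g e₁ y a b = g (Φ (e₁.symm y))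
      (mfderiv (𝓡 4) (𝓡 4) e₂.symm (ψ y) (fderiv ℝ ψ y (EuclideanSpace.single a (1 : ℝ))))
      (mfderiv (𝓡 4) (𝓡 4) e₂.symm (ψ y) (fderiv ℝ ψ y (EuclideanSpace.single b (1 : ℝ)))) := by
    rw [← h5 a, ← h5 b]
    exact (hg _ _ _).symm
  -- The base point is a variable here because the two names of the image point are equal only by
  -- `hinv`, and the form `g q` depends on it.
  have h7 : ∀ q, q = e₂.symm (ψ y) → ∀ u v : E4, g q
      (mfderiv (𝓡 4) (𝓡 4) e₂.symm (ψ y) u) (mfderiv (𝓡 4) (𝓡 4) e₂.symm (ψ y) v)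
      = ∑ a, ∑ b, u a * v b * tensorIn g e₂ (ψ y) a b := by
    rintro q rfl u v
    exact tensor_apply g e₂ _ u v
  rw [h6, h7 _ hinv.symm]
  simp only [Matrix.mul_apply, Matrix.transpose_apply, jac, Matrix.of_apply, Finset.sum_mul,
    pd_coord hψd]
  rw [Finset.sum_comm]
  exact Finset.sum_congr rfl fun c _ => Finset.sum_congr rfl fun d _ => by ring

/-- The scalar curvature is invariant under isometries. -/
lemma IsLorentzMetric.scalarCurvature_isometry [IsManifold (𝓡 4) ∞ M] (h : IsLorentzMetric g) {Φ : M → M}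
    (hΦ : ContMDiff (𝓡 4) (𝓡 4) ∞ Φ)
    (hg : ∀ r v w, g (Φ r) (mfderiv (𝓡 4) (𝓡 4) Φ r v) (mfderiv (𝓡 4) (𝓡 4) Φ r w) = g r v w)
    (p : M) : scalarCurvature g (Φ p) = scalarCurvature g p := by
  have hi := h.isometryOn hΦ hg (IsManifold.chart_mem_maximalAtlas p)
    (IsManifold.chart_mem_maximalAtlas (Φ p))
  have hinv : (chartAt E4 p).symm (chartAt E4 p p) = p :=
    (chartAt E4 p).left_inv (mem_chart_source E4 p)
  have := hi.scalar_eq (x := chartAt E4 p p)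
    ⟨(chartAt E4 p).map_source (mem_chart_source E4 p), by simp [hinv]⟩
  simp only [hinv] at this
  exact this.symm

/-- The scalar curvature can be computed in any chart. -/
lemma IsLorentzMetric.scalarCurvature_chart [IsManifold (𝓡 4) ∞ M] (h : IsLorentzMetric g)
    (he : e ∈ IsManifold.maximalAtlas (𝓡 4) ∞ M) (hx : x ∈ e.target) :
    scalarCurvature g (e.symm x) = trace (tensorIn g e) (ricci (tensorIn g e) x) x := by
  -- The identity, read in two charts, is an isometry: a change of coordinates is a special case.
  have hi := h.isometryOn (Φ := id) contMDiff_id (by simp [mfderiv_id]) he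
    (IsManifold.chart_mem_maximalAtlas (e.symm x))
  exact (hi.scalar_eq (x := x) ⟨hx, by simp⟩).symm

end Manifold

/-! ### Spatially homogeneous spacetimes in charts -/

section Homogeneous

variable {M : Type*} [TopologicalSpace M] [ChartedSpace E4 M]
  {g : ∀ p : M, TangentSpace (𝓡 4) p →L[ℝ] TangentSpace (𝓡 4) p →L[ℝ] ℝ}
  {t : M → ℝ} {n : ∀ p : M, TangentSpace (𝓡 4) p}
  {e : OpenPartialHomeomorph M E4} {x : E4}

lemma vectorIn_apply (n : ∀ p : M, TangentSpace (𝓡 4) p)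
    (he : e ∈ IsManifold.maximalAtlas (𝓡 4) ∞ M) (hx : x ∈ e.target) :
    mfderiv (𝓡 4) (𝓡 4) e.symm x (WithLp.toLp 2 (vectorIn n e x) : E4) = n (e.symm x) :=
  symm_mfderiv_chart he hx (n (e.symm x))

lemma lower_eq_apply (n : ∀ p : M, TangentSpace (𝓡 4) p)
    (he : e ∈ IsManifold.maximalAtlas (𝓡 4) ∞ M) (hx : x ∈ e.target) (b : Fin 4) :
    lower (tensorIn g e) (vectorIn n e) x b = g (e.symm x) (n (e.symm x))
      (mfderiv (𝓡 4) (𝓡 4) e.symm x (EuclideanSpace.single b (1 : ℝ) : E4)) := by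
  rw [← vectorIn_apply n he hx]
  refine Eq.symm ((tensor_apply g e x _ _).trans ?_)
  refine Finset.sum_congr rfl fun a _ => ?_
  simp [mul_comm]

lemma contDiffOn_comp_symm {u : M → ℝ} (hu : ContMDiff (𝓡 4) 𝓘(ℝ, ℝ) ∞ u)
    (he : e ∈ IsManifold.maximalAtlas (𝓡 4) ∞ M) :
    ContDiffOn ℝ ∞ (fun y => u (e.symm y)) e.target := by
  rw [← contMDiffOn_iff_contDiffOn]
  exact hu.comp_contMDiffOn (contMDiffOn_symm_of_mem_maximalAtlas he)

lemma fderiv_comp_symm {u : M → ℝ} (hu : ContMDiff (𝓡 4) 𝓘(ℝ, ℝ) ∞ u)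
    (he : e ∈ IsManifold.maximalAtlas (𝓡 4) ∞ M) (hx : x ∈ e.target) (v : E4) :
    fderiv ℝ (fun y => u (e.symm y)) x v
      = mfderiv (𝓡 4) 𝓘(ℝ, ℝ) u (e.symm x) (mfderiv (𝓡 4) (𝓡 4) e.symm x v) := by
  have h2 : HasMFDerivAt (𝓡 4) 𝓘(ℝ, ℝ) (fun z => u (e.symm z)) x
      ((mfderiv (𝓡 4) 𝓘(ℝ, ℝ) u (e.symm x)).comp (mfderiv (𝓡 4) (𝓡 4) e.symm x)) :=
    HasMFDerivAt.comp x ((hu.mdifferentiable (by simp)) _).hasMFDerivAt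
      ((mdifferentiable_chart he).mdifferentiableAt_symm hx).hasMFDerivAt
  have h3 := differentiableAt_of_smooth e.open_target (contDiffOn_comp_symm hu he) hx
  exact DFunLike.congr_fun (hasMFDerivAt_unique h3.hasFDerivAt.hasMFDerivAt h2) v

variable {f : ℝ → ℝ} {D : Set ℝ}

/-- An equality on the whole model space, not only on the chart target, since f'(R) > 0 at every
point of M. -/
lemma tensorIn_confMetric (hf_pos : ∀ r ∈ D, 0 < deriv f r)
    (hR : ∀ p, scalarCurvature g p ∈ D) : tensorIn (confMetric f g) e
      = scale (fun y => confField f g (e.symm y)) (tensorIn g e) := by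
  funext y
  ext a b
  simp only [scale, confField, Real.exp_log (hf_pos _ (hR _))]
  rfl

lemma vectorIn_confNormal : vectorIn (confNormal f g n) e
    = ClosedUnitOn.scaleVec (fun y => confField f g (e.symm y)) (vectorIn n e) := by
  funext y a
  have : mfderiv (𝓡 4) (𝓡 4) e (e.symm y) (confNormal f g n (e.symm y))
      = Real.exp (-confField f g (e.symm y) / 2) •
        mfderiv (𝓡 4) (𝓡 4) e (e.symm y) (n (e.symm y)) := map_smul _ _ _
  simp only [vectorIn, this]
  rfl

lemma confMetric_confNormal (hf_pos : ∀ r ∈ D, 0 < deriv f r)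
    (hR : ∀ p, scalarCurvature g p ∈ D) (p : M) (v : TangentSpace (𝓡 4) p) :
    confMetric f g p (confNormal f g n p) v = Real.exp (confField f g p / 2) * g p (n p) v := by
  have : Real.exp (confField f g p) * Real.exp (-confField f g p / 2)
      = Real.exp (confField f g p / 2) := by
    rw [← Real.exp_add]; congr 1; ring
  have hF : deriv f (scalarCurvature g p) = Real.exp (confField f g p) :=
    (Real.exp_log (hf_pos _ (hR _))).symm
  simp only [confMetric, confNormal, smul_apply, map_smul, smul_eq_mul]
  rw [hF, ← this]
  ring

namespace IsSpatiallyHomogeneous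

/-- `n_a = -∂_a t`. -/
lemma apply_normal (h : IsSpatiallyHomogeneous g t n) {p : M} {v : TangentSpace (𝓡 4) p} {r : ℝ}
    (hr : mfderiv (𝓡 4) 𝓘(ℝ, ℝ) t p v = r) : g p (n p) v = -r := by
  -- v - r n is tangent to the level set because dt(n) = 1, so n is orthogonal to it.
  have h1 : mfderiv (𝓡 4) 𝓘(ℝ, ℝ) t p (v - r • n p) = (0 : ℝ) := by
    rw [map_sub, map_smul, h.time p, hr]
    change r - r * 1 = 0
    ring
  have h2 := h.orthogonal p _ h1
  rw [map_sub, map_smul, h.unit p, smul_eq_mul] at h2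
  linarith

lemma lower_eq (h : IsSpatiallyHomogeneous g t n)
    (he : e ∈ IsManifold.maximalAtlas (𝓡 4) ∞ M) (hx : x ∈ e.target) (b : Fin 4) :
    lower (tensorIn g e) (vectorIn n e) x b = -pd (fun y => t (e.symm y)) b x := by
  rw [lower_eq_apply n he hx]
  exact h.apply_normal (fderiv_comp_symm h.time_smooth he hx _).symm

lemma fderiv_time (h : IsSpatiallyHomogeneous g t n)
    (he : e ∈ IsManifold.maximalAtlas (𝓡 4) ∞ M) (hx : x ∈ e.target) :
    fderiv ℝ (fun y => t (e.symm y)) x (WithLp.toLp 2 (vectorIn n e x)) = 1 := by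
  rw [fderiv_comp_symm h.time_smooth he hx, vectorIn_apply n he hx]
  exact h.time _

/-- n♭ = -dt is exact. Smoothness of n is a consequence: n^a = -g^{ab} ∂_b t. -/
lemma closedUnitOn (h : IsSpatiallyHomogeneous g t n)
    (he : e ∈ IsManifold.maximalAtlas (𝓡 4) ∞ M) :
    ClosedUnitOn e.target (tensorIn g e) (vectorIn n e) := by
  have hm := h.metric.metricOn he
  have ht := contDiffOn_comp_symm h.time_smooth he
  refine ⟨hm, fun a => ?_, fun y hy => ?_, fun y hy a b => ?_⟩
  · have : ContDiffOn ℝ ∞ (fun y => ∑ b, (tensorIn g e y)⁻¹ a b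
        * -pd (fun z => t (e.symm z)) b y) e.target :=
      ContDiffOn.sum fun b _ => (hm.smooth_inv a b).mul (contDiffOn_pd hm.isOpen ht b).neg
    refine this.congr fun y hy => ?_
    simp only [← h.lower_eq he hy, lower, Finset.mul_sum]
    rw [Finset.sum_comm]
    have (c : Fin 4) : ∑ b, (tensorIn g e y)⁻¹ a b * (tensorIn g e y c b * vectorIn n e y c)
        = (if a = c then 1 else 0) * vectorIn n e y c := by
      rw [← hm.sum_inv_mul hy, Finset.sum_mul]
      exact Finset.sum_congr rfl fun b _ => by rw [hm.symm y hy c b]; ring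
    simp [this]
  · have h1 := h.fderiv_time he hy
    rw [fderiv_apply_eq_sum] at h1
    rw [← h1, ← Finset.sum_neg_distrib]
    exact Finset.sum_congr rfl fun a _ => by rw [h.lower_eq he hy]; ring
  · rw [pd_congr_on hm.isOpen (fun z hz => h.lower_eq he hz b) hy,
      pd_congr_on hm.isOpen (fun z hz => h.lower_eq he hz a) hy, pd_neg, pd_neg]
    rw [show pd (fun z => pd (fun y => t (e.symm y)) b z) a y = _ from
      pd_comm hm.isOpen ht hy b a]

variable [IsManifold (𝓡 4) ∞ M]

/-- The scalar curvature depends on time only. -/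
lemma scalarCurvature_eq (h : IsSpatiallyHomogeneous g t n) {p q : M} (hpq : t p = t q) :
    scalarCurvature g p = scalarCurvature g q := by
  obtain ⟨Φ, hΦ, rfl⟩ := h.homogeneous p q hpq
  exact (h.metric.scalarCurvature_isometry Φ.contMDiff hΦ p).symm

/-- `scalarCurvature` uses a different chart at each point; invariance replaces it on the whole
target by the expression in the single chart `e`. -/
lemma contDiffOn_scalarCurvature (h : IsSpatiallyHomogeneous g t n)
    (he : e ∈ IsManifold.maximalAtlas (𝓡 4) ∞ M) :
    ContDiffOn ℝ ∞ (fun y => scalarCurvature g (e.symm y)) e.target := by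
  have hm := h.metric.metricOn he
  have hr (a b : Fin 4) : ContDiffOn ℝ ∞ (fun y => ricci (tensorIn g e) y a b) e.target := by
    have hc := hm.smooth_christoffel
    exact (ContDiffOn.sum fun c _ => (contDiffOn_pd hm.isOpen (hc c a b) c).sub
      (contDiffOn_pd hm.isOpen (hc c a c) b)).add (ContDiffOn.sum fun c _ => ContDiffOn.sum
        fun d _ => ((hc c c d).mul (hc d a b)).sub ((hc c b d).mul (hc d a c)))
  have : ContDiffOn ℝ ∞ (fun y => trace (tensorIn g e) (ricci (tensorIn g e) y) y) e.target :=
    ContDiffOn.sum fun a _ => ContDiffOn.sum fun b _ => (hm.smooth_inv a b).mul (hr a b)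
  exact this.congr fun y hy => h.metric.scalarCurvature_chart he hy

lemma contDiffOn_confField (h : IsSpatiallyHomogeneous g t n)
    (he : e ∈ IsManifold.maximalAtlas (𝓡 4) ∞ M) (hD : IsOpen D) (hf : ContDiffOn ℝ ∞ f D)
    (hf_pos : ∀ r ∈ D, 0 < deriv f r) (hR : ∀ p, scalarCurvature g p ∈ D) :
    ContDiffOn ℝ ∞ (fun y => confField f g (e.symm y)) e.target := by
  have h1 : ContDiffOn ℝ ∞ (deriv f) D := hf.deriv_of_isOpen hD (by simp)
  exact (h1.comp (h.contDiffOn_scalarCurvature he) fun y _ => hR _).log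
    fun y _ => (hf_pos _ (hR _)).ne'

/-- Homogeneity enters in `parallel`: R is a function of t, so dφ = φ̇ dt = -φ̇ n♭. -/
lemma frameData (h : IsSpatiallyHomogeneous g t n)
    (he : e ∈ IsManifold.maximalAtlas (𝓡 4) ∞ M) (hD : IsOpen D) (hf : ContDiffOn ℝ ∞ f D)
    (hf_pos : ∀ r ∈ D, 0 < deriv f r) (hf_inj : Set.InjOn (deriv f) D)
    (hf_two : ∀ r ∈ D, deriv (deriv f) r ≠ 0) (hR : ∀ p, scalarCurvature g p ∈ D) :
    FrameData e.target (tensorIn g e) (vectorIn n e) (fun y => confField f g (e.symm y)) f D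
      (fun y => scalarCurvature g (e.symm y)) where
  unit := h.closedUnitOn he
  smooth := h.contDiffOn_confField he hD hf hf_pos hR
  parallel y hy a := by
    have hφ := (h.contDiffOn_confField he hD hf hf_pos hR).contDiffAt (e.open_target.mem_nhds hy)
    have ht := (contDiffOn_comp_symm h.time_smooth he).contDiffAt (e.open_target.mem_nhds hy)
    have := fderiv_eq_of_const_on_level (ht.hasStrictFDerivAt (by simp))
      (hφ.hasStrictFDerivAt (by simp)) (h.fderiv_time he hy)
      (Eventually.of_forall fun z hz => by
        simp only [confField, h.scalarCurvature_eq hz]) (EuclideanSpace.single a 1)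
    rw [h.lower_eq he hy, neg_mul_neg]
    rw [fderiv_apply_eq_sum _ _ (WithLp.toLp 2 (vectorIn n e y))] at this
    exact this
  scalar y hy := h.metric.scalarCurvature_chart he hy
  isOpen := hD
  smooth_fun := hf
  injOn := hf_inj
  two := hf_two
  mem y := hR _
  exp_eq y := (Real.exp_log (hf_pos _ (hR _))).symm

lemma isLorentzMetric_confMetric (h : IsSpatiallyHomogeneous g t n) (hD : IsOpen D)
    (hf : ContDiffOn ℝ ∞ f D) (hf_pos : ∀ r ∈ D, 0 < deriv f r)
    (hR : ∀ p, scalarCurvature g p ∈ D) : IsLorentzMetric (confMetric f g) where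
  symm p v w := by
    simp only [confMetric, smul_apply, h.metric.symm p v w]
  signature p := by
    obtain ⟨b, hb⟩ := h.metric.signature p
    have hF := hf_pos _ (hR p)
    set F := deriv f (scalarCurvature g p) with hFd
    -- An orthonormal basis of g, divided by √f', is orthonormal for f' g with the same signs.
    have hs : (Real.sqrt F)⁻¹ ≠ 0 := inv_ne_zero (Real.sqrt_pos.2 hF).ne'
    refine ⟨b.isUnitSMul (w := fun _ => (Real.sqrt F)⁻¹) fun _ => hs.isUnit, fun i j => ?_⟩
    have h1 : F * ((Real.sqrt F)⁻¹ * (Real.sqrt F)⁻¹) = 1 := by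
      rw [← mul_inv, Real.mul_self_sqrt hF.le, mul_inv_cancel₀ hF.ne']
    simp only [Module.Basis.isUnitSMul_apply, confMetric, smul_apply, map_smul, hb, smul_eq_mul]
    rw [← hFd]
    linear_combination (if i = j then if i = 0 then (-1 : ℝ) else 1 else 0) * h1
  smooth e he a b := by
    rw [tensorIn_confMetric hf_pos hR]
    exact ((h.metric.metricOn he).scale (h.contDiffOn_confField he hD hf hf_pos hR)).smooth a b

end IsSpatiallyHomogeneous

end Homogeneous

end ConfRay

/-! ### Assembly of the theorem -/

theorem mainTheorem2 {M : Type*} [TopologicalSpace M] [ChartedSpace ConfRay.E4 M]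
    [IsManifold (𝓡 4) ∞ M]
    (g : ∀ p : M, TangentSpace (𝓡 4) p →L[ℝ] TangentSpace (𝓡 4) p →L[ℝ] ℝ)
    (t : M → ℝ) (n : ∀ p : M, TangentSpace (𝓡 4) p)
    (hom : ConfRay.IsSpatiallyHomogeneous g t n)
    (f : ℝ → ℝ) (D : Set ℝ) (hD : IsOpen D) (hf : ContDiffOn ℝ ∞ f D)
    (hf_pos : ∀ r ∈ D, 0 < deriv f r) (hf_inj : Set.InjOn (deriv f) D)
    (hf_two : ∀ r ∈ D, deriv (deriv f) r ≠ 0)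
    (hR : ∀ p, ConfRay.scalarCurvature g p ∈ D)
    (T : ∀ p : M, TangentSpace (𝓡 4) p →L[ℝ] TangentSpace (𝓡 4) p →L[ℝ] ℝ) :
    -- the conformal frame: a Lorentz metric, and a unit field orthogonal to the same slices
    ConfRay.IsLorentzMetric (ConfRay.confMetric f g) ∧
    (∀ p, ConfRay.confMetric f g p (ConfRay.confNormal f g n p) (ConfRay.confNormal f g n p)
      = -1) ∧
    (∀ p v, mfderiv (𝓡 4) 𝓘(ℝ, ℝ) t p v = (0 : ℝ) →
      ConfRay.confMetric f g p (ConfRay.confNormal f g n p) v = 0) ∧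
    -- the equations, in every chart of the manifold
    ∀ e ∈ IsManifold.maximalAtlas (𝓡 4) ∞ M, ∀ x ∈ e.target,
      ∀ (G S G' S' : ConfRay.E4 → Matrix (Fin 4) (Fin 4) ℝ) (N N' : ConfRay.E4 → Fin 4 → ℝ)
        (R φ : ConfRay.E4 → ℝ) (V : ℝ → ℝ) (W : Matrix (Fin 4) (Fin 4) ℝ),
      G = ConfRay.tensorIn g e →
      N = ConfRay.vectorIn n e →
      S = ConfRay.tensorIn T e →
      (R = fun y => ConfRay.scalarCurvature g (e.symm y)) →
      G' = ConfRay.tensorIn (ConfRay.confMetric f g) e →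
      N' = ConfRay.vectorIn (ConfRay.confNormal f g n) e →
      S' = ConfRay.tensorIn (ConfRay.confMatter f g T) e →
      (φ = fun y => ConfRay.confField f g (e.symm y)) →
      V = ConfRay.potential f D →
      -- the total stress tensor in the conformal frame
      W = ConfRay.scalarStress G' φ V x + S' x →
      -- the original frame: geodesic congruence, Raychaudhuri equation
      (∀ a, ConfRay.acceleration G N x a = 0) ∧
      (∀ a b, ConfRay.extrinsic G N a b x =
        ConfRay.nablaCovector G (ConfRay.lower G N) a b x) ∧
      ConfRay.Raychaudhuri G N (ConfRay.ricci G x) x ∧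
      -- the conformal frame: the conformal Raychaudhuri equation and its reduction
      ConfRay.expansion G' N' x = ConfRay.divergence G' N' x ∧
      ConfRay.AcceleratedRaychaudhuri G' N' x ∧
      (∀ a, ConfRay.acceleration G' N' x a = 0) ∧
      ConfRay.Raychaudhuri G' N' (ConfRay.ricci G' x) x ∧
      -- the two systems of field equations are equivalent
      DifferentiableAt ℝ V (φ x) ∧
      (ConfRay.FREquations f G R S x ↔ ConfRay.einstein G' x = W) ∧
      -- trace of the field equations and scalar wave equation
      (ConfRay.FRTraceEquation f G R S x ↔
        ConfRay.ScalarWave G' N' φ V (-(1 / 3) * ConfRay.trace G' (S' x) x) x) ∧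
      -- Raychaudhuri equation of the `f(R)` theory and Raychaudhuri-wave system
      ((ConfRay.Raychaudhuri G N (ConfRay.frRicci f G R S x) x ∧
          ConfRay.FRTraceEquation f G R S x) ↔
        (ConfRay.Raychaudhuri G' N' (ConfRay.einsteinRicci G' W x) x ∧
          ConfRay.ScalarWave G' N' φ V (-(1 / 3) * ConfRay.trace G' (S' x) x) x)) ∧
      -- solutions of the `f(R)` equations
      (ConfRay.FREquations f G R S x →
        ConfRay.ricci G' x = ConfRay.einsteinRicci G' W x ∧
        ConfRay.Raychaudhuri G' N' (ConfRay.einsteinRicci G' W x) x ∧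
        ConfRay.ScalarWave G' N' φ V (-(1 / 3) * ConfRay.trace G' (S' x) x) x ∧
        (ConfRay.ScalarWave G' N' φ V 0 x ↔ ConfRay.trace G (S x) x = 0)) := by
  have hframe := ConfRay.confMetric_confNormal (g := g) (n := n) hf_pos hR
  refine ⟨hom.isLorentzMetric_confMetric hD hf hf_pos hR, fun p => ?_, fun p v hv => ?_, ?_⟩
  · rw [hframe, ConfRay.confNormal, map_smul, hom.unit, smul_eq_mul, ← mul_assoc, ← Real.exp_add]
    simp [← add_div]
  · rw [hframe, hom.orthogonal p v hv, mul_zero]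
  intro e he x hx G S G' S' N N' R φ V W hG hN hS hRe hG' hN' hS' hφ hV hW
  have h : ConfRay.FrameData e.target G N φ f D R := by
    rw [hG, hN, hRe, hφ]
    exact hom.frameData he hD hf hf_pos hf_inj hf_two hR
  rw [ConfRay.tensorIn_confMetric hf_pos hR, ← hφ, ← hG] at hG'
  rw [ConfRay.vectorIn_confNormal, ← hφ, ← hN] at hN'
  have hSx : S' x = Real.exp (-φ x) • S x := by rw [hS', hS, hφ]; rfl
  have hWs : W = ConfRay.FrameData.stress G φ f D S x := by rw [hW, hSx, hG', hV]; rfl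
  have h' := h.unit.scale h.smooth h.parallel
  have hd := h.unit.metric.det_ne x hx
  have htr : ConfRay.trace G' (S' x) x = Real.exp (-φ x) ^ 2 * ConfRay.trace G (S x) x := by
    rw [hG', hSx, ConfRay.trace_smul, ConfRay.trace_scale hd]
    ring
  have hwave : ConfRay.FRTraceEquation f G R S x ↔
      ConfRay.ScalarWave G' N' φ V (-(1 / 3) * ConfRay.trace G' (S' x) x) x := by
    rw [h.frTraceEquation_iff hx, htr, hG', hN', hV, h.scalarWave_iff (S := S) hx, add_eq_right]
  have hwave0 : ConfRay.trace G (ConfRay.FrameData.residual G φ f R S x) x = 0 →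
      (ConfRay.ScalarWave G' N' φ V 0 x ↔ ConfRay.trace G (S x) x = 0) := by
    intro h0
    have := h.scalarWave_iff (S := S) hx 0
    rw [mul_zero, mul_zero, h0, zero_add] at this
    rwa [hG', hN', hV]
  have hsys : (ConfRay.Raychaudhuri G N (ConfRay.frRicci f G R S x) x ∧
        ConfRay.FRTraceEquation f G R S x) ↔
      (ConfRay.Raychaudhuri G' N' (ConfRay.einsteinRicci G' W x) x ∧
        ConfRay.ScalarWave G' N' φ V (-(1 / 3) * ConfRay.trace G' (S' x) x) x) := by
    rw [← hwave]
    -- The wave and trace equations are already equivalent, so tr E = 0 may be assumed; then trace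
    -- reversal does nothing and both Raychaudhuri equations read E(n,n) = 0.
    refine and_congr_left fun h0 => ?_
    rw [h.frTraceEquation_iff hx] at h0
    rw [hG', hN', hWs, h.raychaudhuri_iff hx, h.raychaudhuri_scale_iff hx, h0, mul_zero, zero_smul,
      sub_zero]
  refine ⟨h.unit.acceleration_eq_zero hx, h.unit.extrinsic_eq hx, h.unit.raychaudhuri hx, ?_, ?_, ?_,
    ?_, ?_, ?_, hwave, hsys, fun hfr => ?_⟩
  · rw [hG', hN']; exact h'.expansion_eq_divergence hx
  · rw [hG', hN']; exact h'.acceleratedRaychaudhuri hx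
  · rw [hG', hN']; exact h'.acceleration_eq_zero hx
  · rw [hG', hN']; exact h'.raychaudhuri hx
  · rw [hV]; exact (h.hasDerivAt_potential x).differentiableAt
  · rw [hG', hWs]; exact h.einstein_iff hx
  have h0 := (h.frEquations_iff hx).1 hfr
  have ht0 : ConfRay.trace G (ConfRay.FrameData.residual G φ f R S x) x = 0 := by
    rw [h0]; simp [ConfRay.trace]
  have hric : ConfRay.ricci G' x = ConfRay.einsteinRicci G' W x := by
    rw [hG', hWs, h.ricci_scale_eq (S := S) hx, ht0, h0]
    simp
  refine ⟨hric, ?_, hwave.1 ((h.frTraceEquation_iff hx).2 ht0), hwave0 ht0⟩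
  rw [← hric, hG', hN']
  exact h'.raychaudhuri hx
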